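/- Let $p$ be a prime and let $G$ be a group of order $p^n$ with a filtration $\{1\}=G_{(n)}<G_{(n-1)}<\dots<G_{(1)}<G_{(0)}=G$ by normal subgroups of $G$ with $|G_{(i)}|=p^{n-i}$. Let $\Sigma_G$ be the set of all $1\le i\le n$ such that the extension $G/G_{(i)}$ of $G/G_{(i-1)}$ by $G_{(i-1)}/G_{(i)}$ is split. A commutative ring $S$ is called a Galois extension of a subring $R$ with group $\Gamma$ if $\Gamma$ is a finite group of automorphisms of $S$, $R=S^{\Gamma}$, and for every maximal ideal $M\subset S$ and every $1\ne\sigma\in\Gamma$ there is $s\in S$ with $\sigma(s)-s\notin M$. For $1\le i\le n$ let $D_i\in\mathbb{F}_p[Y_1,\dots,Y_{i-1}]$ be polynomials with the following properties. First, $D_i=0$ for $i\in\Sigma_G$ and $D_i\notin\mathbb{F}_p$ for $i\notin\Sigma_G$. Second, put $S_i=\mathbb{F}_p[Y_1,\dots,Y_i]$, $X_i=Y_i^p-Y_i-D_i$ and $R_i=\mathbb{F}_p[X_1,\dots,X_i]\subset S_i$; then for $0\le i\le n$ the ring $S_i$ is a Galois extension of $R_i$ with group $\mathrm{Gal}(S_i/R_i)$,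 the group of all automorphisms of $S_i$ fixing $R_i$. Third, there are isomorphisms $\lambda_i:\mathrm{Gal}(S_i/R_i)\to G/G_{(i)}$ for $0\le i\le n$ such that for $1\le i\le n$ restriction of automorphisms from $S_i$ to $S_{i-1}$ corresponds under $\lambda_i,\lambda_{i-1}$ to the projection $G/G_{(i)}\to G/G_{(i-1)}$. (Such polynomials exist for every such filtered group.) Let $l_i$ be the total degree of $D_i$. Let $K$ be a field of characteristic $p$ that is complete with respect to a normalized discrete valuation $v_K$ and has perfect residue field; extend $v_K$ to a separable closure $K^{sep}$. Let $u_1<u_2<\dots<u_n$ be positive integers with $p\nmid u_i$, and let $a_1,\dots,a_n\in K$ satisfy $v_K(a_i)=-u_i$. Define $K_0=K$ and $K_i=K_{i-1}(\alpha_i)$ for $1\le i\le n$, where $\alpha_i\in K^{sep}$ satisfies $\alpha_i^p-\alpha_i=d_i+a_i$ with $d_i=D_i(\alpha_1,\dots,\alpha_{i-1})$. Define $b_1,\dots,b_n$ by $b_1=u_1$ and $b_{i+1}-b_i=p^i(u_{i+1}-u_i)$ for $1\le i\le n-1$. If $b_i>p^{i-2}\,l_i\,u_{i-1}$ for all $1\le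 i\le n$ with $i\notin\Sigma_G$ (such $i$ satisfy $i\ge2$), then: (a) $K_n/K$ is Galois, and there is an isomorphism $\mu:\mathrm{Gal}(K_n/K)\to G$ such that $\mu(\mathrm{Gal}(K_n/K_i))=G_{(i)}$ for $0\le i\le n$. (b) The upper ramification breaks of $K_n/K$ are exactly $u_1,\dots,u_n$ and the lower ramification breaks are exactly $b_1,\dots,b_n$. Furthermore, $v_K(\alpha_i)=-u_i/p$ for $1\le i\le n$. (c) The ramification subgroups of $\mathrm{Gal}(K_n/K)$ (those of the lower numbering, $G_t$ for real $t\ge-1$, and equally those of the upper numbering, $G^x$ for real $x\ge-1$) are exactly the subgroups $\mathrm{Gal}(K_n/K_i)$ for $0\le i\le n$. -/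

import Mathlib

open scoped Valued WithZero

noncomputable section

namespace RamTower

/-! ### `p`-filtered groups -/

/-- A `p`-filtered group of order `p ^ n`: normal subgroups
`1 = G_(n) < G_(n-1) < ⋯ < G_(1) < G_(0) = G` of `G` with `|G_(i)| = p ^ (n - i)`.
The sequence is indexed by all naturals; because of the truncated subtraction in `card_sub`
it is continued by the trivial subgroup after the index `n`. -/
structure PFilteredGroup (p n : ℕ) (G : Type*) [Group G] where
  sub : ℕ → Subgroup G
  sub_zero : sub 0 = ⊤
  normal : ∀ i, (sub i).Normal
  anti : Antitone sub
  card_sub : ∀ i, Nat.card (sub i) = p ^ (n - i)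

attribute [instance] PFilteredGroup.normal

namespace PFilteredGroup

variable {p n : ℕ} {G : Type*} [Group G] (F : PFilteredGroup p n G)

/-- The projection `G / G_(j) → G / G_(i)` for `i ≤ j`. -/
def proj {i j : ℕ} (h : i ≤ j) : G ⧸ F.sub j →* G ⧸ F.sub i :=
  QuotientGroup.map (F.sub j) (F.sub i) (MonoidHom.id G) (F.anti h)

/-- `Σ_G`: the indices `1 ≤ i ≤ n` for which the extension `G / G_(i)` of `G / G_(i-1)` by
`G_(i-1) / G_(i)` is split. -/
def splitSet : Set ℕ :=
  {i | 1 ≤ i ∧ i ≤ n ∧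
    ∃ s : G ⧸ F.sub (i - 1) →* G ⧸ F.sub i, ∀ x, F.proj (Nat.sub_le i 1) (s x) = x}

end PFilteredGroup

/-! ### Galois extensions of commutative rings and the generic extension -/

/-- The commutative ring `S` is a Galois extension of its subring `R` with group `Γ`:
`Γ` is a finite group of automorphisms of `S`, `R = S ^ Γ`, and for every maximal ideal `M`
and every `σ ≠ 1` in `Γ` there is `s` with `σ s - s ∉ M`. -/
def IsGaloisRingExt {S : Type*} [CommRing S] (R : Subring S) (Γ : Subgroup (S ≃+* S)) : Prop :=
  Finite Γ ∧ (∀ x : S, x ∈ R ↔ ∀ σ ∈ Γ, σ x = x) ∧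
    ∀ M : Ideal S, M.IsMaximal → ∀ σ ∈ Γ, σ ≠ 1 → ∃ s : S, σ s - s ∉ M

section Generic

variable {p : ℕ}

/-- `S_i = 𝔽_p[Y_1, …, Y_i]`, inside the polynomial ring in the variables `Y_j`, `j : ℕ`.
The ring `S_i` obtained recursively from `S_0 = 𝔽_p` by
`S_i = S_{i-1}[Y_i, X_i] / (Y_i ^ p - Y_i - D_i - X_i)` is this polynomial ring, with
`X_i = Y_i ^ p - Y_i - D_i`. -/
def genS (p i : ℕ) : Subalgebra (ZMod p) (MvPolynomial ℕ (ZMod p)) :=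
  MvPolynomial.supported (ZMod p) (Set.Icc 1 i)

/-- The element `X_i = Y_i ^ p - Y_i - D_i`. -/
def genX (D : ℕ → MvPolynomial ℕ (ZMod p)) (i : ℕ) : MvPolynomial ℕ (ZMod p) :=
  MvPolynomial.X i ^ p - MvPolynomial.X i - D i

/-- `R_i = 𝔽_p[X_1, …, X_i]`, as a subring of `S_i`. -/
def genR (D : ℕ → MvPolynomial ℕ (ZMod p)) (i : ℕ) : Subring (genS p i) :=
  ((Algebra.adjoin (ZMod p) (genX D '' Set.Icc 1 i)).comap (genS p i).val).toSubring

/-- `Gal(S_i / R_i)`: all ring automorphisms of `S_i` that fix `R_i` pointwise. -/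
def genGal (D : ℕ → MvPolynomial ℕ (ZMod p)) (i : ℕ) : Subgroup (genS p i ≃+* genS p i) :=
  fixingSubgroup (genS p i ≃+* genS p i) (genR D i : Set (genS p i))

/-- The polynomials `D_1, …, D_n` give a generic extension for the `p`-filtered group `F`
(only the values `D i` with `1 ≤ i ≤ n` matter):
`D_i ∈ 𝔽_p[Y_1, …, Y_{i-1}]`, which is `0` for `i ∈ Σ_G` and not constant for `i ∉ Σ_G`; each
`S_i / R_i` is Galois; and there are isomorphisms `λ_i : Gal(S_i / R_i) ≃ G / G_(i)` that turn
restriction from `S_i` to `S_{i-1}` into the projection `G / G_(i) → G / G_(i-1)`. -/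
structure IsGenericSystem {n : ℕ} {G : Type*} [Group G] (F : PFilteredGroup p n G)
    (D : ℕ → MvPolynomial ℕ (ZMod p)) : Prop where
  mem_supported : ∀ i, 1 ≤ i → i ≤ n → D i ∈ MvPolynomial.supported (ZMod p) (Set.Ico 1 i)
  eq_zero : ∀ i ∈ F.splitSet, D i = 0
  not_const : ∀ i, 1 ≤ i → i ≤ n → i ∉ F.splitSet →
    D i ∉ Set.range (MvPolynomial.C : ZMod p → MvPolynomial ℕ (ZMod p))
  galois : ∀ i, i ≤ n → IsGaloisRingExt (genR D i) (genGal D i)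
  exists_iso : ∃ lam : ∀ i, i ≤ n → (genGal D i ≃* G ⧸ F.sub i),
    ∀ (i : ℕ) (hi : i + 1 ≤ n) (σ : genGal D (i + 1)), ∃ τ : genGal D i,
      (∀ (x : genS p i) (y : genS p (i + 1)), (x : MvPolynomial ℕ (ZMod p)) = y →
        ((τ.1 x : genS p i) : MvPolynomial ℕ (ZMod p)) = σ.1 y) ∧
      lam i ((Nat.le_succ i).trans hi) τ = F.proj (Nat.le_succ i) (lam (i + 1) hi σ)

end Generic

/-! ### Valuations on algebraic extensions of a complete discretely valued field -/

section Ramification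

variable (K : Type*) [Field K] [Valued K ℤᵐ⁰] {E : Type*} [Field E] [Algebra K E]

/-- The valuation `v_K`, written additively and extended to an algebraic extension `E` of the
complete field `K`: `v_K(0) = ∞`, and `v_K(x) = v_K(c) / d` for `x ≠ 0`, where `c` is the
constant coefficient and `d` the degree of the minimal polynomial of `x` over `K`, so that
`c` is the norm of `x` from `K(x)` to `K` up to sign. (On `K` itself, `v_K` is minus the
logarithm of the multiplicative valuation.) -/
def extVal (x : E) : EReal :=
  open scoped Classical in
  if x = 0 then ⊤
  else ((-((WithZero.log (Valued.v ((minpoly K x).coeff 0)) : ℤ) : ℝ) /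
    ((minpoly K x).natDegree : ℝ) : ℝ) : EReal)

/-- The ramification index `e` of `L / K`: the least positive integer `e` such that
`e * v_K` is integral on `L^×`. -/
def ramIndex (L : IntermediateField K E) : ℕ :=
  sInf {e : ℕ | 0 < e ∧ ∀ x ∈ L, x ≠ 0 → ∃ m : ℤ, (e : EReal) * extVal K x = ((m : ℝ) : EReal)}

/-- The normalized valuation `v_L = e * v_K`, for which `v_L(L^×) = ℤ`. -/
def normVal (L : IntermediateField K E) (x : E) : EReal :=
  (ramIndex K L : EReal) * extVal K x

variable {K}

/-- A uniformizer `π_L` of `L`. -/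
def uniformizer (L : IntermediateField K E) : L :=
  Classical.epsilon fun x : L => normVal K L (x : E) = 1

/-- `σ` lies in the inertia group: it acts trivially on the residue field of `L`. -/
def InInertia (L : IntermediateField K E) (σ : L ≃ₐ[K] L) : Prop :=
  ∀ x : L, 0 ≤ normVal K L (x : E) → 0 < normVal K L ((σ x - x : L) : E)

/-- The ramification number: `i(σ) = v_L(σ(π_L) - π_L) - 1` for `σ` in the inertia group and
`i(σ) = -1` otherwise. -/
def ramNumber (L : IntermediateField K E) (σ : L ≃ₐ[K] L) : EReal :=
  open scoped Classical in
  if InInertia L σ then normVal K L ((σ (uniformizer L) - uniformizer L : L) : E) - 1 else -1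

/-- The lower ramification subgroup `G_t = {σ | i(σ) ≥ t}` of `G = Gal(L / K)`. -/
def lowerRam (L : IntermediateField K E) (t : ℝ) : Set (L ≃ₐ[K] L) :=
  {σ | (t : EReal) ≤ ramNumber L σ}

/-- The Hasse-Herbrand function `φ_{L/K}(x) = ∫_0^x dt / |G_0 : G_t|`. -/
def herbrand (L : IntermediateField K E) (x : ℝ) : ℝ :=
  ∫ t in (0 : ℝ)..x, ((lowerRam L t).ncard : ℝ) / ((lowerRam L 0).ncard : ℝ)

/-- The inverse `ψ_{L/K}` of `φ_{L/K} : [-1, ∞) → [-1, ∞)`. -/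
def herbrandInv (L : IntermediateField K E) : ℝ → ℝ :=
  Function.invFunOn (herbrand L) (Set.Ici (-1))

/-- The upper ramification subgroup `G^x = G_{ψ(x)}`. -/
def upperRam (L : IntermediateField K E) (x : ℝ) : Set (L ≃ₐ[K] L) :=
  lowerRam L (herbrandInv L x)

/-- The lower ramification breaks: `b ≥ -1` with `G_b ≠ G_{b+ε}` for all `ε > 0`. -/
def lowerBreaks (L : IntermediateField K E) : Set ℝ :=
  {b | -1 ≤ b ∧ ∀ ε : ℝ, 0 < ε → lowerRam L b ≠ lowerRam L (b + ε)}

/-- The upper ramification breaks: `u ≥ -1` with `G^u ≠ G^{u+ε}` for all `ε > 0`. -/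
def upperBreaks (L : IntermediateField K E) : Set ℝ :=
  {u | -1 ≤ u ∧ ∀ ε : ℝ, 0 < ε → upperRam L u ≠ upperRam L (u + ε)}

variable (K)

/-- The tower `K_0 = K`, `K_{i+1} = K_i(α_{i+1})`. -/
def tower (α : ℕ → E) : ℕ → IntermediateField K E
  | 0 => ⊥
  | i + 1 => tower α i ⊔ IntermediateField.adjoin K {α (i + 1)}

/-- `Gal(K_n / K_i)` as a subgroup of `Gal(K_n / K)`, for `i ≤ n`. -/
def towerGal (α : ℕ → E) (n i : ℕ) : Subgroup (tower K α n ≃ₐ[K] tower K α n) :=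
  ((tower K α i).comap (tower K α n).val).fixingSubgroup

/-- The value at `α` of a polynomial with coefficients in the prime field. -/
def evalAt {p : ℕ} [CharP K p] (α : ℕ → E) (P : MvPolynomial ℕ (ZMod p)) : E :=
  MvPolynomial.eval₂ ((algebraMap K E).comp (ZMod.castHom (dvd_refl p) K)) α P

end Ramification

end RamTower

end

/-! The valuation of `K` extends to a valuation on `E` through the spectral norm, and the argument
climbs the tower with it, showing that each step is totally ramified of degree `p`. Pole orders
below are measured by this extended valuation, scaled to be integral on the field at hand.

Suppose `L / K` is totally ramified of degree `N`, and `β ^ p - β ∈ L` has pole order `b > 0` prime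
to `p`. The nonzero terms of a sum `∑ x_k β ^ k`, `k < p`, have orders distinct modulo `p`, so no
cancellation occurs. Hence `L(β) / L` is totally ramified of degree `p` (`TotRam.sup_adjoin`), and
the action of an automorphism can be read off the dominant term (`TotRam.hasRamBreak_sup_adjoin`).

The given generator `α_{i+1}` does not have this shape over `K_i`: the pole of `a_{i+1}`, measured
in `K_i`, is divisible by `p` once `i > 0`. It is reduced by subtracting elements `z ^ p - z`. If `s
> b` is prime to `p`, an element of `L` of pole order `s` can be brought to order `p s - (p - 1) b`
in `L(β)` (`TotRam.exists_sub_artinSchreier_eq`). Iterating through `K_1, …, K_i` takes `u_{i+1}` to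
`b_{i+1}` (`exists_reduction_in_tower`); this is where the recursion for `b` comes from. The
hypothesis on `l_i` says that `d_{i+1}` has a smaller pole than what remains, so `α_{i+1} - z` is a
reduced generator (`totRam_tower`).

An automorphism fixing `K_i` but not `K_{i+1}` shifts the reduced generator of `K_{i+1}` by a
nonzero constant of `𝔽_p`, so its ramification number there is `b_{i+1}`. The number persists
further up because the later `b_j` are larger (`hasRamBreak_tower`). This gives the lower
filtration, and integrating the slopes `p ^ (-i)` gives the upper one.

For the Galois group, the conjugates of `α` solve the same system as `α`, and any two solutions
differ by an automorphism of the generic extension (`IsGenericSystem.exists_genGal_of_solution`).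
Thus `K_n / K` is normal, and comparing orders identifies its group with `Gal(S_n / R_n)`, that is,
with `G` (`exists_mulEquiv_gal`). -/

noncomputable section

namespace RamTower

/-! ### The extension of the valuation of `K` to `E`. -/

section ValuationOnE

open WithZero

/-- The real number `e`, as the base of a norm. -/
def normBase : NNReal := Real.toNNReal (Real.exp 1)

theorem coe_normBase : (normBase : ℝ) = Real.exp 1 := Real.coe_toNNReal _ (Real.exp_pos 1).le

theorem one_lt_normBase : 1 < normBase := by
  rw [← NNReal.coe_lt_coe, coe_normBase]
  exact Real.one_lt_exp_iff.2 one_pos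

variable {K : Type*} [Field K] [Valued K ℤᵐ⁰] {E : Type*} [Field E] [Algebra K E]

/-- The rank one structure of a `ℤᵐ⁰`-valued field whose norm is `exp (log v)`. -/
@[reducible] def rankOneExp (h : Valuation.IsNontrivial (Valued.v : Valuation K ℤᵐ⁰)) :
    Valuation.RankOne (Valued.v : Valuation K ℤᵐ⁰) where
  hom' := (WithZeroMulInt.toNNReal one_lt_normBase.ne_zero).comp
      MonoidWithZeroHom.ValueGroup₀.embedding
  strictMono' := (WithZeroMulInt.toNNReal_strictMono one_lt_normBase).comp
      MonoidWithZeroHom.ValueGroup₀.embedding_strictMono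
  exists_val_nontrivial := h.exists_val_nontrivial

theorem rankOneExp_norm (h : Valuation.IsNontrivial (Valued.v : Valuation K ℤᵐ⁰)) {x : K}
    (hx : x ≠ 0) :
    ((Valued.v : Valuation K ℤᵐ⁰).norm (hv := rankOneExp h) x) =
      Real.exp (log (Valued.v x) : ℤ) := by
  have hv : (Valued.v x : ℤᵐ⁰) ≠ 0 := (Valuation.ne_zero_iff _).2 hx
  change ((WithZeroMulInt.toNNReal one_lt_normBase.ne_zero
    (MonoidWithZeroHom.ValueGroup₀.embedding (Valued.v.restrict x)) : NNReal) : ℝ) = _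
  rw [Valuation.embedding_restrict, WithZeroMulInt.toNNReal_neg_apply _ hv,
    WithZero.toAdd_unzero_eq_log, NNReal.coe_zpow, coe_normBase,
    ← Real.rpow_intCast, Real.exp_one_rpow]

/-- Over a complete field the spectral norm is multiplicative and equals the `d`-th root of the norm
of the constant coefficient of the minimal polynomial, which is the formula defining `extVal`. The
proof of the tower works with `w`; `extVal` returns only when the ramification numbers are read off.
-/
theorem exists_valuation [CompleteSpace K] [Algebra.IsAlgebraic K E]
    (hsurj : Function.Surjective (Valued.v : Valuation K ℤᵐ⁰)) :
    ∃ w : Valuation E ℝᵐ⁰,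
      (∀ x : E, x ≠ 0 → extVal K x = ((-(log (w x)) : ℝ) : EReal)) ∧
      ∀ c : K, c ≠ 0 → w (algebraMap K E c) = exp ((log (Valued.v c) : ℤ) : ℝ) := by
  have hnt : Valuation.IsNontrivial (Valued.v : Valuation K ℤᵐ⁰) := by
    obtain ⟨x, hx⟩ := hsurj (exp 1)
    refine ⟨⟨x, ?_, ?_⟩⟩
    · rw [hx]; exact exp_ne_zero
    · rw [hx]; simp
  let _ := rankOneExp hnt
  have hpos : ∀ x : E, x ≠ 0 → 0 < spectralNorm K E x := fun x hx =>
    spectralNorm_zero_lt hx (Algebra.IsAlgebraic.isAlgebraic x)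
  have hmul : ∀ x y : E, spectralNorm K E (x * y) = spectralNorm K E x * spectralNorm K E y :=
    fun x y => map_mul (spectralMulAlgNorm K E) x y
  have hlog : ∀ x : E, x ≠ 0 → Real.log (spectralNorm K E x) =
      (log (Valued.v ((minpoly K x).coeff 0)) : ℤ) / ((minpoly K x).natDegree : ℝ) := by
    intro x hx
    have hc : (minpoly K x).coeff 0 ≠ 0 :=
      minpoly.coeff_zero_ne_zero (Algebra.IsIntegral.isIntegral x) hx
    rw [spectralNorm.spectralNorm_eq_norm_coeff_zero_rpow, Real.log_rpow (norm_pos_iff.2 hc)]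
    have := rankOneExp_norm hnt hc
    change ‖(minpoly K x).coeff 0‖ = _ at this
    rw [this, Real.log_exp]
    ring
  classical
  refine ⟨⟨⟨⟨fun x => if x = 0 then 0 else exp (Real.log (spectralNorm K E x)), if_pos rfl⟩,
    ?_, ?_⟩, ?_⟩, ?_, ?_⟩
  · simp [spectralNorm_one]
  · intro x y
    by_cases hx : x = 0
    · simp [hx]
    by_cases hy : y = 0
    · simp [hy]
    simp only [mul_eq_zero, hx, hy, or_self, if_false]
    rw [hmul, Real.log_mul (hpos x hx).ne' (hpos y hy).ne', exp_add]
  · intro x y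
    by_cases hx : x = 0
    · simp [hx]
    by_cases hy : y = 0
    · simp [hy]
    by_cases hxy : x + y = 0
    · simp [hxy]
    simp only [hx, hy, hxy, if_false, le_max_iff, exp_le_exp]
    rcases le_max_iff.1 (isNonarchimedean_spectralNorm (K := K) x y) with h | h
    · exact Or.inl (Real.log_le_log (hpos _ hxy) h)
    · exact Or.inr (Real.log_le_log (hpos _ hxy) h)
  · intro x hx
    change extVal K x = ((-(log (if x = 0 then (0 : ℝᵐ⁰) else _)) : ℝ) : EReal)
    rw [if_neg hx, log_exp, hlog x hx, extVal, if_neg hx, neg_div]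
  · intro c hc
    change (if algebraMap K E c = 0 then (0 : ℝᵐ⁰) else _) = _
    rw [if_neg (by simpa using hc), spectralNorm_extends]
    have := rankOneExp_norm hnt hc
    change ‖c‖ = _ at this
    rw [this, Real.log_exp]

/-- `extVal` depends only on the minimal polynomial, which conjugate elements share. -/
theorem valuation_algHom [Algebra.IsAlgebraic K E] {w : Valuation E ℝᵐ⁰}
    (hw : ∀ x : E, x ≠ 0 → extVal K x = ((-(log (w x)) : ℝ) : EReal)) (φ : E →ₐ[K] E) (x : E) :
    w (φ x) = w x := by
  by_cases hx : x = 0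
  · simp [hx]
  have hφ : φ x ≠ 0 := by simpa using hx
  have h : extVal K (φ x) = extVal K x := by
    rw [extVal, extVal, if_neg hx, if_neg hφ, minpoly.algHom_eq φ φ.injective]
  rw [hw x hx, hw _ hφ, EReal.coe_eq_coe_iff, neg_inj] at h
  rw [← exp_log ((Valuation.ne_zero_iff w).2 hφ), h, exp_log ((Valuation.ne_zero_iff w).2 hx)]

/-- Frobenius is surjective on the perfect residue field, which has characteristic `p`. -/
theorem exists_pow_sub_valuation_lt_one (p : ℕ) [Fact p.Prime] [CharP K p] [PerfectField 𝓀[K]]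
    {c : K} (hc : (Valued.v c : ℤᵐ⁰) ≤ 1) : ∃ d : K, (Valued.v (d ^ p - c) : ℤᵐ⁰) < 1 := by
  have hp0 : ((p : ℕ) : 𝓀[K]) = 0 := by
    have : ((p : ℕ) : 𝒪[K]) = 0 := by
      apply Subtype.ext
      simp
    rw [← map_natCast (IsLocalRing.residue 𝒪[K]), this, map_zero]
  have : CharP 𝓀[K] p := by
    have := CharP.ringChar_of_prime_eq_zero (Fact.out : p.Prime) hp0
    exact ringChar.of_eq this
  have := PerfectField.toPerfectRing (K := 𝓀[K]) p
  obtain ⟨r, hr⟩ := (PerfectRing.bijective_frobenius (R := 𝓀[K]) (p := p)).2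
    (IsLocalRing.residue 𝒪[K] ⟨c, hc⟩)
  obtain ⟨d, rfl⟩ := IsLocalRing.residue_surjective r
  refine ⟨d, ?_⟩
  change (IsLocalRing.residue 𝒪[K] d) ^ p = _ at hr
  rw [← map_pow, ← sub_eq_zero, ← map_sub, IsLocalRing.residue_eq_zero_iff,
    IsLocalRing.mem_maximalIdeal, mem_nonunits_iff,
    Valuation.Integer.not_isUnit_iff_valuation_lt_one] at hr
  exact hr

theorem valuation_algebraMap_le_one_iff {w : Valuation E ℝᵐ⁰}
    (hw : ∀ c : K, c ≠ 0 → w (algebraMap K E c) = exp ((log (Valued.v c) : ℤ) : ℝ)) (c : K) :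
    w (algebraMap K E c) ≤ 1 ↔ (Valued.v c : ℤᵐ⁰) ≤ 1 := by
  by_cases hc : c = 0
  · simp [hc]
  rw [hw c hc, ← exp_zero, exp_le_exp, ← Int.cast_zero, Int.cast_le,
    log_le_iff_le_exp ((Valuation.ne_zero_iff _).2 hc), exp_zero]

theorem valuation_algebraMap_lt_one_iff {w : Valuation E ℝᵐ⁰}
    (hw : ∀ c : K, c ≠ 0 → w (algebraMap K E c) = exp ((log (Valued.v c) : ℤ) : ℝ)) (c : K) :
    w (algebraMap K E c) < 1 ↔ (Valued.v c : ℤᵐ⁰) < 1 := by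
  by_cases hc : c = 0
  · simp [hc]
  rw [hw c hc, ← exp_zero, exp_lt_exp, ← Int.cast_zero, Int.cast_lt,
    log_lt_iff_lt_exp ((Valuation.ne_zero_iff _).2 hc), exp_zero]

end ValuationOnE

/-! ### Ultrametric estimates for powers and Artin-Schreier roots. -/

section ValuationArithmetic

open WithZero

theorem exp_real_pow (r : ℝ) (k : ℕ) : (exp r : ℝᵐ⁰) ^ k = exp ((k : ℝ) * r) := by
  rw [← exp_nsmul, nsmul_eq_mul]

theorem exp_real_zpow (r : ℝ) (k : ℤ) : (exp r : ℝᵐ⁰) ^ k = exp ((k : ℝ) * r) := by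
  rw [← exp_zsmul, zsmul_eq_mul]

theorem eq_exp_div_of_pow_eq {p : ℕ} (hp : p ≠ 0) {x : ℝᵐ⁰} {r : ℝ} (h : x ^ p = exp r) :
    x = exp (r / p) := by
  have hx : x ≠ 0 := by
    rintro rfl
    rw [zero_pow hp] at h
    exact exp_ne_zero h.symm
  obtain ⟨s, rfl⟩ : ∃ s : ℝ, x = exp s := ⟨log x, (exp_log hx).symm⟩
  rw [exp_real_pow, exp_inj] at h
  rw [exp_inj, ← h]
  field_simp

variable {E : Type*} [Field E] (v : Valuation E ℝᵐ⁰)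

theorem valuation_natCast_le_one (j : ℕ) : v (j : E) ≤ 1 := by
  induction j with
  | zero => simp
  | succ j ih =>
    rw [Nat.cast_succ]
    exact (v.map_add _ _).trans (max_le ih (by simp))

/-- First-order binomial expansion. When `p ∤ j` the linear term `j δ` dominates, which gives the
exact value in `valuation_one_add_pow_sub_one_eq`. -/
theorem valuation_one_add_pow_sub_le {δ : E} (hδ : v δ ≤ 1) (j : ℕ) :
    v ((1 + δ) ^ j - 1 - j * δ) ≤ v δ ^ 2 := by
  induction j with
  | zero => simp
  | succ j ih =>
    have h : (1 + δ) ^ (j + 1) - 1 - ((j + 1 : ℕ) : E) * δ =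
        ((1 + δ) ^ j - 1 - j * δ) * (1 + δ) + j * δ ^ 2 := by
      push_cast
      ring
    rw [h]
    refine (v.map_add _ _).trans (max_le ?_ ?_)
    · rw [map_mul]
      refine (mul_le_of_le_one_right' ?_).trans ih
      exact (v.map_add _ _).trans (max_le (by simp) hδ)
    · rw [map_mul, map_pow]
      exact mul_le_of_le_one_left' (valuation_natCast_le_one v j)

theorem valuation_one_add_pow_sub_one_le {δ : E} (hδ : v δ ≤ 1) (j : ℕ) :
    v ((1 + δ) ^ j - 1) ≤ v δ := by
  have h : (1 + δ) ^ j - 1 = ((1 + δ) ^ j - 1 - j * δ) + j * δ := by ring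
  rw [h]
  refine (v.map_add _ _).trans (max_le ?_ ?_)
  · refine (valuation_one_add_pow_sub_le v hδ j).trans ?_
    rw [pow_two]
    exact mul_le_of_le_one_right' hδ
  · rw [map_mul]
    exact mul_le_of_le_one_left' (valuation_natCast_le_one v j)

theorem valuation_one_add_pow_sub_one_eq {δ : E} (hδ : v δ < 1) {j : ℕ} (hj : v (j : E) = 1) :
    v ((1 + δ) ^ j - 1) = v δ := by
  by_cases h0 : δ = 0
  · simp [h0]
  have h : (1 + δ) ^ j - 1 = ((1 + δ) ^ j - 1 - j * δ) + j * δ := by ring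
  have h1 : v ((j : E) * δ) = v δ := by rw [map_mul, hj, one_mul]
  rw [h, v.map_add_eq_of_lt_right, h1]
  rw [h1]
  refine (valuation_one_add_pow_sub_le v hδ.le j).trans_lt ?_
  rw [pow_two]
  exact mul_lt_of_lt_one_right (zero_lt_iff.2 ((Valuation.ne_zero_iff v).2 h0)) hδ

/-- A pole of `g` forces a pole of `w`, and then `w ^ p` dominates `w`. -/
theorem valuation_of_artinSchreier {p : ℕ} [Fact p.Prime] {w g : E} {r : ℝ} (hr : 0 < r)
    (h : w ^ p - w = g) (hg : v g = exp r) : v w = exp (r / p) := by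
  have hp := (Fact.out : p.Prime)
  apply eq_exp_div_of_pow_eq hp.ne_zero
  have h1 : 1 < v w := by
    by_contra! hle
    have : v g ≤ 1 := by
      rw [← h]
      refine (v.map_sub _ _).trans (max_le ?_ hle)
      rw [map_pow]
      exact pow_le_one₀ zero_le hle
    rw [hg, ← exp_zero, exp_le_exp] at this
    linarith
  rw [← hg, ← h, v.map_sub_eq_of_lt_left, map_pow]
  rw [map_pow]
  exact lt_self_pow₀ h1 hp.one_lt

/-- Here `w` is a root of unity of order dividing `p - 1`, and the value group is torsion-free. -/
theorem valuation_eq_one_of_pow_eq {p : ℕ} [Fact p.Prime] {w : E} (hw : w ≠ 0)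
    (h : w ^ p - w = 0) : v w = 1 := by
  have hp := (Fact.out : p.Prime)
  have h1 : w ^ (p - 1) = 1 := by
    have : w * w ^ (p - 1) = w * 1 := by
      rw [mul_one, ← pow_succ', Nat.sub_add_cancel hp.one_le]
      exact sub_eq_zero.1 h
    exact mul_left_cancel₀ hw this
  have h2 : v w ^ (p - 1) = 1 := by rw [← map_pow, h1, map_one]
  rw [← exp_zero] at h2
  simpa using eq_exp_div_of_pow_eq (Nat.sub_pos_of_lt hp.one_lt).ne' h2

theorem valuation_natCast_eq_one (p : ℕ) [Fact p.Prime] [CharP E p] {j : ℕ} (hj : ¬ p ∣ j) :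
    v (j : E) = 1 := by
  refine valuation_eq_one_of_pow_eq v (p := p) (mt (CharP.cast_eq_zero_iff E p j).1 hj) ?_
  rw [← frobenius_def, map_natCast, sub_self]

end ValuationArithmetic

/-! ### Expansions in powers of an element whose order is prime to `p`. -/

section TotallyRamified

open WithZero

variable {K : Type*} [Field K] {E : Type*} [Field E] [Algebra K E] (v : Valuation E ℝᵐ⁰)

/-- `L / K` is totally ramified of degree `N` with respect to `v`, where `v` takes the values
`exp m`, `m : ℤ`, on `K^×`. -/
structure TotRam (L : IntermediateField K E) (N : ℕ) : Prop where
  pos : 0 < N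
  val : ∀ x ∈ L, x ≠ 0 → ∃ m : ℤ, v x = exp ((m : ℝ) / (N : ℝ))
  exists_val : ∀ m : ℤ, ∃ x ∈ L, v x = exp ((m : ℝ) / (N : ℝ))
  residue : ∀ x ∈ L, v x ≤ 1 → ∃ c : K, v (x - algebraMap K E c) < 1
  finrank : Module.finrank K L = N

variable {v} {L : IntermediateField K E} {N p : ℕ} [hp : Fact p.Prime]

theorem TotRam.eq_index_of_valuation_eq (hL : TotRam v L N) {β : E} {b : ℤ}
    (hβ : v β = exp ((b : ℝ) / ((p * N : ℕ) : ℝ))) {x : E} (hx : x ∈ L) (hx0 : x ≠ 0) {j : ℕ}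
    {m : ℤ} (h : v (x * β ^ j) = exp ((m : ℝ) / ((p * N : ℕ) : ℝ))) :
    (p : ℤ) ∣ m - j * b := by
  obtain ⟨t, ht⟩ := hL.val x hx hx0
  have hN : (N : ℝ) ≠ 0 := by exact_mod_cast hL.pos.ne'
  have hp0 : (p : ℝ) ≠ 0 := by exact_mod_cast hp.out.ne_zero
  rw [map_mul, map_pow, hβ, ht, exp_real_pow, ← exp_add, exp_inj] at h
  push_cast at h
  field_simp at h
  refine ⟨t, ?_⟩
  have : (m : ℝ) - j * b = p * t := by linarith
  exact_mod_cast this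

theorem index_eq_of_dvd {b : ℤ} (hb : ¬ (p : ℤ) ∣ b) {m : ℤ} {j k : ℕ} (hj : j < p) (hk : k < p)
    (h1 : (p : ℤ) ∣ m - j * b) (h2 : (p : ℤ) ∣ m - k * b) : j = k := by
  have h : (p : ℤ) ∣ ((j : ℤ) - k) * b := by
    have h := dvd_sub h2 h1
    rwa [show m - k * b - (m - j * b) = ((j : ℤ) - k) * b by ring] at h
  have hpp : Prime (p : ℤ) := Nat.prime_iff_prime_int.1 hp.out
  have h3 : (p : ℤ) ∣ (j : ℤ) - k := (hpp.dvd_or_dvd h).resolve_right hb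
  have h4 : k ≡ j [MOD p] := (Nat.modEq_iff_dvd).2 h3
  exact (Nat.ModEq.eq_of_lt_of_lt h4 hk hj).symm

theorem TotRam.valuation_mul_pow (hL : TotRam v L N) {β : E} {b : ℤ}
    (hβ : v β = exp ((b : ℝ) / ((p * N : ℕ) : ℝ))) {x : E} (hx : x ∈ L) (hx0 : x ≠ 0) (j : ℕ) :
    ∃ m : ℤ, v (x * β ^ j) = exp ((m : ℝ) / ((p * N : ℕ) : ℝ)) := by
  obtain ⟨t, ht⟩ := hL.val x hx hx0
  have hN : (N : ℝ) ≠ 0 := by exact_mod_cast hL.pos.ne'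
  have hp0 : (p : ℝ) ≠ 0 := by exact_mod_cast hp.out.ne_zero
  refine ⟨p * t + j * b, ?_⟩
  rw [map_mul, map_pow, hβ, ht, exp_real_pow, ← exp_add, exp_inj]
  push_cast
  field_simp

/-- In units of `1 / (p N)` the coefficient contributes a multiple of `p` and `β ^ k` contributes `k
b`. Since `p ∤ b`, distinct `k < p` give distinct residues modulo `p`, so the maximum is attained
only once. -/
theorem TotRam.valuation_sum_pow (hL : TotRam v L N) {β : E} {b : ℤ}
    (hβ : v β = exp ((b : ℝ) / ((p * N : ℕ) : ℝ))) (hb : ¬ (p : ℤ) ∣ b) {x : ℕ → E}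
    (hx : ∀ j, x j ∈ L) (h0 : ∃ j < p, x j ≠ 0) :
    ∃ j < p, x j ≠ 0 ∧ v (∑ k ∈ Finset.range p, x k * β ^ k) = v (x j * β ^ j) ∧
      ∀ k < p, k ≠ j → v (x k * β ^ k) < v (x j * β ^ j) := by
  have hβ0 : β ≠ 0 := by
    rintro rfl
    rw [map_zero] at hβ
    exact exp_ne_zero hβ.symm
  obtain ⟨j, hj, hmax⟩ := Finset.exists_max_image (Finset.range p) (fun k => v (x k * β ^ k))
    ⟨0, Finset.mem_range.2 hp.out.pos⟩
  rw [Finset.mem_range] at hj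
  have hxj : x j ≠ 0 := by
    intro hxj
    obtain ⟨k, hk, hxk⟩ := h0
    have := hmax k (Finset.mem_range.2 hk)
    rw [hxj, zero_mul, map_zero, nonpos_iff_eq_zero, Valuation.zero_iff] at this
    exact (mul_ne_zero hxk (pow_ne_zero _ hβ0)) this
  have hlt : ∀ k < p, k ≠ j → v (x k * β ^ k) < v (x j * β ^ j) := by
    intro k hk hkj
    refine lt_of_le_of_ne (hmax k (Finset.mem_range.2 hk)) fun heq => hkj ?_
    obtain ⟨m, hm⟩ := hL.valuation_mul_pow hβ (hx j) hxj j
    have hxk : x k ≠ 0 := by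
      intro hxk
      rw [hxk, zero_mul, map_zero, hm] at heq
      exact exp_ne_zero heq.symm
    exact index_eq_of_dvd hb hk hj (hL.eq_index_of_valuation_eq hβ (hx k) hxk (heq.trans hm))
      (hL.eq_index_of_valuation_eq hβ (hx j) hxj hm)
  refine ⟨j, hj, hxj, ?_, hlt⟩
  rw [← Finset.add_sum_erase _ _ (Finset.mem_range.2 hj)]
  apply v.map_add_eq_of_lt_left
  refine v.map_sum_lt ?_ fun k hk => ?_
  · exact (Valuation.ne_zero_iff v).2 (mul_ne_zero hxj (pow_ne_zero _ hβ0))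
  · exact hlt k (Finset.mem_range.1 (Finset.mem_of_mem_erase hk)) (Finset.ne_of_mem_erase hk)

open Polynomial in
-- Division with remainder by the monic polynomial `X ^ p - X - f`; its irreducibility is not
-- needed.
theorem exists_eq_sum_of_mem_sup_adjoin {β f : E} (hf : f ∈ L) (hβf : β ^ p - β = f) {y : E}
    (hy : y ∈ L ⊔ IntermediateField.adjoin K {β}) :
    ∃ x : ℕ → E, (∀ j, x j ∈ L) ∧ y = ∑ k ∈ Finset.range p, x k * β ^ k := by
  set g : L[X] := X ^ p - (X + C ⟨f, hf⟩) with hg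
  have hdeg : (X + C (⟨f, hf⟩ : L)).degree < (p : WithBot ℕ) := by
    rw [degree_X_add_C]
    exact_mod_cast hp.out.one_lt
  have hmon : g.Monic := monic_X_pow_sub hdeg
  have hroot : aeval β g = 0 := by
    simp only [hg, map_sub, map_pow, aeval_X, map_add, aeval_C]
    change β ^ p - (β + f) = 0
    rw [← hβf]
    ring
  have halg : IsAlgebraic L β := ⟨g, hmon.ne_zero, hroot⟩
  rw [← IntermediateField.restrictScalars_adjoin_eq_sup, IntermediateField.mem_restrictScalars,
    ← IntermediateField.mem_toSubalgebra,
    IntermediateField.adjoin_simple_toSubalgebra_of_isAlgebraic halg,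
    Algebra.adjoin_singleton_eq_range_aeval] at hy
  obtain ⟨q, hq⟩ := hy
  have hdg : (q %ₘ g).natDegree < p := by
    have h1 : g.natDegree = p := by
      rw [hg, natDegree_sub_eq_left_of_natDegree_lt, natDegree_X_pow]
      rw [natDegree_X_pow, natDegree_X_add_C]
      exact hp.out.one_lt
    have := natDegree_modByMonic_lt q hmon (fun h => by
      rw [h, natDegree_one] at h1
      exact hp.out.ne_zero h1.symm)
    rwa [h1] at this
  refine ⟨fun j => ((q %ₘ g).coeff j : E), fun j => ((q %ₘ g).coeff j).2, ?_⟩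
  have h2 : aeval β (q %ₘ g) = y := by
    rw [aeval_modByMonic_eq_self_of_root hroot]
    exact hq
  rw [← h2, aeval_eq_sum_range' hdg]
  rfl

end TotallyRamified

/-! ### Artin-Schreier extensions that are totally ramified of degree `p`. -/

section Extension

open WithZero

variable {K : Type*} [Field K] {E : Type*} [Field E] [Algebra K E] {v : Valuation E ℝᵐ⁰}
  {L : IntermediateField K E} {N p : ℕ} [hp : Fact p.Prime]

theorem mem_sup_adjoin_left {β x : E} (hx : x ∈ L) : x ∈ L ⊔ IntermediateField.adjoin K {β} :=
  (le_sup_left : L ≤ _) hx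

theorem mem_sup_adjoin_self (L : IntermediateField K E) (β : E) :
    β ∈ L ⊔ IntermediateField.adjoin K {β} :=
  (le_sup_right : _ ≤ L ⊔ IntermediateField.adjoin K {β})
    (IntermediateField.mem_adjoin_simple_self K β)

open Polynomial in
-- A minimal polynomial of degree less than `p` would make a sum as in `TotRam.valuation_sum_pow`
-- vanish, although its leading coefficient is `1`.
theorem TotRam.finrank_sup_adjoin (hL : TotRam v L N) {β f : E} {b : ℤ} (hf : f ∈ L)
    (hβf : β ^ p - β = f) (hβ : v β = exp ((b : ℝ) / ((p * N : ℕ) : ℝ))) (hb : ¬ (p : ℤ) ∣ b) :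
    Module.finrank K ↥(L ⊔ IntermediateField.adjoin K {β}) = p * N := by
  set g : L[X] := X ^ p - (X + C ⟨f, hf⟩) with hg
  have hdeg : (X + C (⟨f, hf⟩ : L)).degree < (p : WithBot ℕ) := by
    rw [degree_X_add_C]
    exact_mod_cast hp.out.one_lt
  have hmon : g.Monic := monic_X_pow_sub hdeg
  have hroot : aeval β g = 0 := by
    simp only [hg, map_sub, map_pow, aeval_X, map_add, aeval_C]
    change β ^ p - (β + f) = 0
    rw [← hβf]
    ring
  have h1 : g.natDegree = p := by
    rw [hg, natDegree_sub_eq_left_of_natDegree_lt, natDegree_X_pow]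
    rw [natDegree_X_pow, natDegree_X_add_C]
    exact hp.out.one_lt
  have hint : IsIntegral L β := ⟨g, hmon, hroot⟩
  have hmin : (minpoly L β).natDegree = p := by
    apply le_antisymm
    · rw [← h1]
      exact natDegree_le_natDegree (minpoly.min L β hmon hroot)
    · by_contra! hlt
      have h2 := minpoly.aeval L β
      rw [aeval_eq_sum_range' hlt] at h2
      obtain ⟨j, -, hj0, hj, -⟩ := hL.valuation_sum_pow hβ hb
        (x := fun j => ((minpoly L β).coeff j : E)) (fun j => ((minpoly L β).coeff j).2)
        ⟨(minpoly L β).natDegree, hlt, by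
          have := minpoly.monic hint
          rw [Monic, leadingCoeff] at this
          rw [this]
          exact one_ne_zero⟩
      change (∑ k ∈ Finset.range p, ((minpoly L β).coeff k : E) * β ^ k) = 0 at h2
      rw [h2, map_zero, eq_comm, Valuation.zero_iff] at hj
      refine mul_ne_zero hj0 (pow_ne_zero _ ?_) hj
      rintro rfl
      rw [map_zero] at hβ
      exact exp_ne_zero hβ.symm
  rw [← IntermediateField.restrictScalars_adjoin_eq_sup]
  change Module.finrank K (IntermediateField.adjoin L {β}) = p * N
  rw [← Module.finrank_mul_finrank K L, hL.finrank, IntermediateField.adjoin.finrank hint, hmin,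
    mul_comm]

/-- Adjoining an Artin-Schreier root whose valuation is prime to `p` gives a totally ramified
extension of degree `p`. -/
theorem TotRam.sup_adjoin (hL : TotRam v L N) {β f : E} {b : ℤ} (hf : f ∈ L)
    (hβf : β ^ p - β = f) (hβ : v β = exp ((b : ℝ) / ((p * N : ℕ) : ℝ))) (hb : ¬ (p : ℤ) ∣ b) :
    TotRam v (L ⊔ IntermediateField.adjoin K {β}) (p * N) := by
  have hN : (N : ℝ) ≠ 0 := by exact_mod_cast hL.pos.ne'
  have hp0 : (p : ℝ) ≠ 0 := by exact_mod_cast hp.out.ne_zero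
  have hne : ∀ {x : ℕ → E}, (∑ k ∈ Finset.range p, x k * β ^ k) ≠ 0 → ∃ j < p, x j ≠ 0 := by
    intro x h
    by_contra! hx
    exact h (Finset.sum_eq_zero fun k hk => by rw [hx k (Finset.mem_range.1 hk), zero_mul])
  refine ⟨Nat.mul_pos hp.out.pos hL.pos, ?_, ?_, ?_, hL.finrank_sup_adjoin hf hβf hβ hb⟩
  · intro y hy hy0
    obtain ⟨x, hx, rfl⟩ := exists_eq_sum_of_mem_sup_adjoin hf hβf hy
    obtain ⟨j, -, hj0, hj, -⟩ := hL.valuation_sum_pow hβ hb hx (hne hy0)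
    rw [hj]
    exact hL.valuation_mul_pow hβ (hx j) hj0 j
  · intro m
    -- By Bézout, `m = (m s) p + (m t) b`: the first summand is realised in `L`, the second by a
    -- power of `β`.
    obtain ⟨s, t, hst⟩ : ∃ s t : ℤ, s * p + t * b = 1 := by
      have : IsCoprime (p : ℤ) b :=
        (Nat.prime_iff_prime_int.1 hp.out).irreducible.coprime_iff_not_dvd.2 hb
      exact this
    obtain ⟨x, hx, hxv⟩ := hL.exists_val (m * s)
    refine ⟨x * β ^ (m * t), mul_mem (mem_sup_adjoin_left hx)
      (zpow_mem (mem_sup_adjoin_self L β) _), ?_⟩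
    rw [map_mul, map_zpow₀, hxv, hβ, exp_real_zpow, ← exp_add, exp_inj]
    have : (s : ℝ) * p + t * b = 1 := by exact_mod_cast hst
    push_cast
    field_simp
    linear_combination (m : ℝ) * this
  · intro y hy hy1
    obtain ⟨x, hx, rfl⟩ := exists_eq_sum_of_mem_sup_adjoin hf hβf hy
    by_cases h0 : ∃ j < p, x j ≠ 0
    swap
    · refine ⟨0, ?_⟩
      push Not at h0
      rw [Finset.sum_eq_zero fun k hk => by rw [h0 k (Finset.mem_range.1 hk), zero_mul]]
      simp
    obtain ⟨j, hj, hj0, hjv, hlt⟩ := hL.valuation_sum_pow hβ hb hx h0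
    have hle : ∀ k < p, v (x k * β ^ k) ≤ 1 := by
      intro k hk
      by_cases hkj : k = j
      · rw [hkj, ← hjv]; exact hy1
      · exact (hlt k hk hkj).le.trans (hjv ▸ hy1)
    have h0p : (0 : ℕ) ∈ Finset.range p := Finset.mem_range.2 hp.out.pos
    -- Only the term `k = 0` can be a unit, because the order of any other nonzero term is prime to
    -- `p`. The residue of the sum is therefore that of `x 0`.
    obtain ⟨c, hc⟩ := hL.residue (x 0) (hx 0) (by simpa using hle 0 hp.out.pos)
    refine ⟨c, ?_⟩
    rw [← Finset.add_sum_erase _ _ h0p, pow_zero, mul_one, add_sub_right_comm]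
    refine v.map_add_lt hc (v.map_sum_lt one_ne_zero fun k hk => ?_)
    have hkp := Finset.mem_range.1 (Finset.mem_of_mem_erase hk)
    refine lt_of_le_of_ne (hle k hkp) fun h1 => Finset.ne_of_mem_erase hk ?_
    by_cases hxk : x k = 0
    · rw [hxk, zero_mul, map_zero] at h1
      exact absurd h1 zero_ne_one
    · have := hL.eq_index_of_valuation_eq hβ (hx k) hxk (m := 0) (by rw [h1]; simp)
      exact index_eq_of_dvd hb hkp hp.out.pos this (by simp)

end Extension

/-! ### Lowering pole orders modulo elements `z ^ p - z`. -/

section Reduction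

open WithZero

variable {K : Type*} [Field K] {E : Type*} [Field E] [Algebra K E] {v : Valuation E ℝᵐ⁰}
  {L : IntermediateField K E} {N p : ℕ} [hp : Fact p.Prime]

/-- The orders are matched by solving `p t + j b = s`. The quotient is then a unit whose residue
comes from `K` and is a `p`-th power `d ^ p`; the factor `d` is absorbed into `x`. -/
theorem TotRam.exists_pow_mul_pow_approx (hL : TotRam v L N)
    (hperf : ∀ c : K, v (algebraMap K E c) ≤ 1 → ∃ d : K, v (algebraMap K E (d ^ p - c)) < 1)
    {f : E} (hf : f ∈ L) {b : ℤ} (hfv : v f = exp ((b : ℝ) / N)) (hb : ¬ (p : ℤ) ∣ b)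
    {y : E} (hy : y ∈ L) {s : ℤ} (hys : v y = exp ((s : ℝ) / N)) :
    ∃ j : ℕ, ∃ x ∈ L, v (x ^ p * f ^ j) = exp ((s : ℝ) / N) ∧
      v (y - x ^ p * f ^ j) < exp ((s : ℝ) / N) ∧ (¬ (p : ℤ) ∣ s → ¬ p ∣ j) := by
  have hN : (N : ℝ) ≠ 0 := by exact_mod_cast hL.pos.ne'
  have hb0 : (b : ZMod p) ≠ 0 := fun h => hb ((ZMod.intCast_zmod_eq_zero_iff_dvd b p).1 h)
  -- The exponent `j` is the representative of `s / b` modulo `p`.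
  obtain ⟨t, ht⟩ : (p : ℤ) ∣ s - (((s : ZMod p) / b).val : ℤ) * b := by
    rw [← ZMod.intCast_zmod_eq_zero_iff_dvd]
    push_cast
    rw [ZMod.natCast_zmod_val, div_mul_cancel₀ _ hb0, sub_self]
  generalize ((s : ZMod p) / b).val = j at ht
  obtain ⟨x, hx, hxt⟩ := hL.exists_val t
  have hx0 : x ^ p * f ^ j ≠ 0 := by
    rw [← Valuation.ne_zero_iff v, map_mul, map_pow, map_pow, hxt, hfv]
    exact mul_ne_zero (pow_ne_zero _ exp_ne_zero) (pow_ne_zero _ exp_ne_zero)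
  have hxv : v (x ^ p * f ^ j) = exp ((s : ℝ) / N) := by
    rw [map_mul, map_pow, map_pow, hxt, hfv, exp_real_pow, exp_real_pow, ← exp_add, exp_inj]
    have : (s : ℝ) - j * b = p * t := by exact_mod_cast ht
    field_simp
    linear_combination -this
  have hr : v (y / (x ^ p * f ^ j)) = 1 := by
    rw [map_div₀, hxv, hys, div_self exp_ne_zero]
  obtain ⟨c, hc⟩ := hL.residue _ (div_mem hy (mul_mem (pow_mem hx p) (pow_mem hf j))) hr.le
  have hc1 : v (algebraMap K E c) ≤ 1 := by
    rw [show algebraMap K E c = y / (x ^ p * f ^ j) - (y / (x ^ p * f ^ j) - algebraMap K E c) by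
      ring]
    exact (v.map_sub _ _).trans (max_le hr.le hc.le)
  obtain ⟨d, hd⟩ := hperf c hc1
  have hd1 : v (y / (x ^ p * f ^ j) - algebraMap K E d ^ p) < 1 := by
    rw [show y / (x ^ p * f ^ j) - algebraMap K E d ^ p = (y / (x ^ p * f ^ j) - algebraMap K E c)
      - algebraMap K E (d ^ p - c) by rw [map_sub, map_pow]; ring]
    exact (v.map_sub _ _).trans_lt (max_lt hc hd)
  have hlt : v (y - (algebraMap K E d * x) ^ p * f ^ j) < exp ((s : ℝ) / N) := by
    rw [show y - (algebraMap K E d * x) ^ p * f ^ j =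
      (y / (x ^ p * f ^ j) - algebraMap K E d ^ p) * (x ^ p * f ^ j) by
        rw [sub_mul, div_mul_cancel₀ _ hx0]; ring, map_mul, hxv]
    exact mul_lt_of_lt_one_left exp_pos hd1
  refine ⟨j, algebraMap K E d * x, mul_mem (L.algebraMap_mem d) hx, ?_, hlt, ?_⟩
  · rw [show (algebraMap K E d * x) ^ p * f ^ j = y - (y - (algebraMap K E d * x) ^ p * f ^ j) by
      ring, v.map_sub_eq_of_lt_left, hys]
    rwa [hys]
  · rintro hs hj
    apply hs
    have : s = p * t + j * b := by linarith
    rw [this]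
    exact dvd_add (dvd_mul_right _ _) ((Int.natCast_dvd_natCast.2 hj).mul_right _)

/-- The valuation of `x ^ p * f ^ j - x ^ p * β ^ (p * j)` where `f = β ^ p - β`. -/
theorem valuation_artinSchreier_pow_sub [CharP E p] {β x f : E} {b r : ℝ}
    (hβf : β ^ p - β = f) (hβ : v β = exp b) (hb : 0 < b) {j : ℕ}
    (hxf : v (x ^ p * f ^ j) = exp r) :
    v (x * β ^ j) = exp (r / p) ∧
      v (x ^ p * f ^ j - (x * β ^ j) ^ p) ≤ exp (r - (p - 1) * b) ∧
      (¬ p ∣ j → v (x ^ p * f ^ j - (x * β ^ j) ^ p) = exp (r - (p - 1) * b)) := by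
  have hβ0 : β ≠ 0 := by
    rintro rfl
    rw [map_zero] at hβ
    exact exp_ne_zero hβ.symm
  have hp1 := hp.out.one_lt
  have hfv : v f = v (β ^ p) := by
    rw [← hβf, v.map_sub_eq_of_lt_left]
    rw [map_pow]
    refine lt_self_pow₀ ?_ hp1
    rw [hβ, ← exp_zero, exp_lt_exp]
    exact hb
  have h1 : v (x * β ^ j) ^ p = exp r := by
    rw [← hxf, ← map_pow, mul_pow, ← pow_mul, mul_comm j p, pow_mul, map_mul, map_mul,
      map_pow v (β ^ p), map_pow v f, hfv]
  -- With this choice `f = β ^ p * (1 + δ)`, so the difference is `(x β ^ j) ^ p` times `(1 + δ) ^ j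
  -- - 1`.
  set δ : E := -(β ^ (p - 1))⁻¹ with hδ
  have hδv : v δ = exp (-((p - 1) * b)) := by
    rw [hδ, Valuation.map_neg, map_inv₀, map_pow, hβ, exp_real_pow, ← exp_neg,
      Nat.cast_sub hp1.le, Nat.cast_one]
  have hδ1 : v δ < 1 := by
    rw [hδv, ← exp_zero, exp_lt_exp]
    have : (1 : ℝ) < p := by exact_mod_cast hp1
    nlinarith
  have hfδ : f = β ^ p * (1 + δ) := by
    rw [← hβf, hδ]
    have : β ^ p = β ^ (p - 1) * β := by rw [← pow_succ, Nat.sub_add_cancel hp1.le]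
    rw [this]
    field_simp
    ring
  have heq : x ^ p * f ^ j - (x * β ^ j) ^ p = (x * β ^ j) ^ p * ((1 + δ) ^ j - 1) := by
    rw [hfδ, mul_pow (β ^ p)]
    ring
  have hexp : (exp (r - (p - 1) * b) : ℝᵐ⁰) = v ((x * β ^ j) ^ p) * v δ := by
    rw [map_pow, h1, hδv, ← exp_add, sub_eq_add_neg]
  refine ⟨eq_exp_div_of_pow_eq hp.out.ne_zero h1, ?_, fun hj => ?_⟩
  · rw [heq, map_mul, hexp]
    exact mul_le_mul_right (valuation_one_add_pow_sub_one_le v hδ1.le j) _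
  · rw [heq, map_mul, hexp,
      valuation_one_add_pow_sub_one_eq v hδ1 (valuation_natCast_eq_one v p hj)]

/-- Induction on the pole order, removing a leading term `x ^ p f ^ j` each time. Subtracting `z ^ p
- z` with `z = x β ^ j` leaves `x ^ p f ^ j - z ^ p`, bounded by the first entry of the maximum, and
`z` itself, bounded by the second. -/
theorem TotRam.exists_sub_artinSchreier_le [CharP E p] (hL : TotRam v L N)
    (hperf : ∀ c : K, v (algebraMap K E c) ≤ 1 → ∃ d : K, v (algebraMap K E (d ^ p - c)) < 1)
    {β f : E} (hf : f ∈ L) {b : ℤ} (hβf : β ^ p - β = f)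
    (hβ : v β = exp ((b : ℝ) / ((p * N : ℕ) : ℝ))) (hb : ¬ (p : ℤ) ∣ b) (hb0 : 0 < b) (s : ℕ)
    {y : E} (hy : y ∈ L) (hys : v y ≤ exp ((s : ℝ) / N)) :
    ∃ z ∈ L ⊔ IntermediateField.adjoin K {β}, v (y - (z ^ p - z)) ≤
      exp (max ((s : ℝ) / N - (p - 1) * (b / ((p * N : ℕ) : ℝ))) ((s : ℝ) / N / p)) := by
  have hN : (0 : ℝ) < N := by exact_mod_cast hL.pos
  have hp0 : (0 : ℝ) < p := by exact_mod_cast hp.out.pos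
  have hbr : (0 : ℝ) < b / ((p * N : ℕ) : ℝ) := by
    push_cast
    have : (0 : ℝ) < b := by exact_mod_cast hb0
    positivity
  have hfv : v f = exp ((b : ℝ) / N) := by
    rw [← hβf, v.map_sub_eq_of_lt_left]
    · rw [map_pow, hβ, exp_real_pow, exp_inj]
      push_cast
      field_simp
    · rw [map_pow]
      refine lt_self_pow₀ ?_ hp.out.one_lt
      rwa [hβ, ← exp_zero, exp_lt_exp]
  induction s generalizing y with
  | zero =>
    refine ⟨0, zero_mem _, ?_⟩
    rw [zero_pow hp.out.ne_zero, sub_zero, sub_zero]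
    refine hys.trans ?_
    rw [exp_le_exp]
    simp
  | succ s ih =>
    have hmono : max ((s : ℝ) / N - (p - 1) * (b / ((p * N : ℕ) : ℝ))) ((s : ℝ) / N / p) ≤
        max (((s + 1 : ℕ) : ℝ) / N - (p - 1) * (b / ((p * N : ℕ) : ℝ)))
          (((s + 1 : ℕ) : ℝ) / N / p) := by
      push_cast
      gcongr <;> linarith
    -- Orders on `L` lie in `(1 / N) ℤ`, so a strict drop is a drop by a full step.
    have hstep : ∀ y' ∈ L, v y' < exp (((s + 1 : ℕ) : ℝ) / N) → v y' ≤ exp ((s : ℝ) / N) := by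
      intro y' hy' hlt
      by_cases h0 : y' = 0
      · simp [h0]
      obtain ⟨m, hm⟩ := hL.val y' hy' h0
      rw [hm, exp_lt_exp, div_lt_div_iff_of_pos_right hN] at hlt
      rw [hm, exp_le_exp, div_le_div_iff_of_pos_right hN]
      have : m < (s + 1 : ℕ) := by exact_mod_cast hlt
      have : m ≤ s := by push_cast at this; omega
      exact_mod_cast this
    rcases hys.lt_or_eq with hlt | heq
    · obtain ⟨z, hz, hzv⟩ := ih hy (hstep y hy hlt)
      exact ⟨z, hz, hzv.trans (exp_le_exp.2 hmono)⟩
    · obtain ⟨j, x, hx, hxv, hlt, -⟩ := hL.exists_pow_mul_pow_approx hperf hf hfv hb hy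
        (s := (s + 1 : ℕ)) (by rw [heq]; push_cast; rfl)
      push_cast at hxv hlt
      obtain ⟨h1, h2, -⟩ := valuation_artinSchreier_pow_sub hβf hβ hbr hxv
      have hy1 : y - x ^ p * f ^ j ∈ L := sub_mem hy (mul_mem (pow_mem hx p) (pow_mem hf j))
      obtain ⟨z, hz, hzv⟩ := ih hy1 (hstep _ hy1 (by push_cast; exact hlt))
      refine ⟨x * β ^ j + z, add_mem (mul_mem (mem_sup_adjoin_left hx)
        (pow_mem (mem_sup_adjoin_self L β) j)) hz, ?_⟩
      rw [show y - ((x * β ^ j + z) ^ p - (x * β ^ j + z)) =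
        (x ^ p * f ^ j - (x * β ^ j) ^ p) + x * β ^ j + (y - x ^ p * f ^ j - (z ^ p - z)) by
          rw [add_pow_char]; ring]
      refine (v.map_add _ _).trans (max_le ((v.map_add _ _).trans (max_le ?_ ?_)) ?_)
      · refine h2.trans (exp_le_exp.2 (le_max_of_le_left ?_))
        push_cast
        exact le_rfl
      · rw [h1]
        refine exp_le_exp.2 (le_max_of_le_right ?_)
        push_cast
        exact le_rfl
      · exact hzv.trans (exp_le_exp.2 hmono)

/-- Modulo `z ^ p - z`, an element of `L` with pole order `s` prime to `p` and bigger than the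
ramification break `b` of `L(β) / L` has pole order `p s - (p - 1) b` in `L(β)`. -/
theorem TotRam.exists_sub_artinSchreier_eq [CharP E p] (hL : TotRam v L N)
    (hperf : ∀ c : K, v (algebraMap K E c) ≤ 1 → ∃ d : K, v (algebraMap K E (d ^ p - c)) < 1)
    {β f : E} (hf : f ∈ L) {b : ℤ} (hβf : β ^ p - β = f)
    (hβ : v β = exp ((b : ℝ) / ((p * N : ℕ) : ℝ))) (hb : ¬ (p : ℤ) ∣ b) (hb0 : 0 < b)
    {s : ℤ} (hsb : b < s) (hps : ¬ (p : ℤ) ∣ s)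
    {y : E} (hy : y ∈ L) (hys : v y = exp ((s : ℝ) / N)) :
    ∃ z ∈ L ⊔ IntermediateField.adjoin K {β}, v (y - (z ^ p - z)) =
      exp (((p * s - (p - 1) * b : ℤ) : ℝ) / ((p * N : ℕ) : ℝ)) := by
  have hN : (0 : ℝ) < N := by exact_mod_cast hL.pos
  have hp0 : (0 : ℝ) < p := by exact_mod_cast hp.out.pos
  have hp1 : (1 : ℝ) < p := by exact_mod_cast hp.out.one_lt
  have hbr0 : (0 : ℝ) < b := by exact_mod_cast hb0
  have hsr : (b : ℝ) < s := by exact_mod_cast hsb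
  have hbr : (0 : ℝ) < b / ((p * N : ℕ) : ℝ) := by
    push_cast
    positivity
  have hfv : v f = exp ((b : ℝ) / N) := by
    rw [← hβf, v.map_sub_eq_of_lt_left]
    · rw [map_pow, hβ, exp_real_pow, exp_inj]
      push_cast
      field_simp
    · rw [map_pow]
      refine lt_self_pow₀ ?_ hp.out.one_lt
      rwa [hβ, ← exp_zero, exp_lt_exp]
  obtain ⟨j, x, hx, hxv, hlt, hj⟩ := hL.exists_pow_mul_pow_approx hperf hf hfv hb hy hys
  obtain ⟨h1, -, h2⟩ := valuation_artinSchreier_pow_sub hβf hβ hbr hxv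
  replace h2 := h2 (hj hps)
  have hy1 : y - x ^ p * f ^ j ∈ L := sub_mem hy (mul_mem (pow_mem hx p) (pow_mem hf j))
  have hcast : (((s - 1).toNat : ℕ) : ℝ) = s - 1 := by
    have : (((s - 1).toNat : ℕ) : ℤ) = s - 1 := Int.toNat_of_nonneg (by omega)
    exact_mod_cast this
  obtain ⟨z, hz, hzv⟩ := hL.exists_sub_artinSchreier_le hperf hf hβf hβ hb hb0 (s - 1).toNat hy1
    (by
      by_cases h0 : y - x ^ p * f ^ j = 0
      · simp [h0]
      obtain ⟨m, hm⟩ := hL.val _ hy1 h0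
      rw [hm, exp_lt_exp, div_lt_div_iff_of_pos_right hN] at hlt
      rw [hm, exp_le_exp, div_le_div_iff_of_pos_right hN, hcast]
      have : m < s := by exact_mod_cast hlt
      have : m ≤ s - 1 := by omega
      exact_mod_cast this)
  -- The condition `b < s` enters here: it is equivalent to `s < p s - (p - 1) b`, so the leftover
  -- `x β ^ j` has a smaller pole than the main term.
  have hlt2 : (s : ℝ) / N / p < s / N - (p - 1) * (b / ((p * N : ℕ) : ℝ)) := by
    push_cast
    rw [← sub_pos]
    have : (s : ℝ) / N - (p - 1) * (b / (p * N)) - s / N / p = (p - 1) * (s - b) / (p * N) := by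
      field_simp
      ring
    rw [this]
    have h3 : (0 : ℝ) < p - 1 := by linarith
    have h4 : (0 : ℝ) < s - b := by linarith
    positivity
  refine ⟨x * β ^ j + z, add_mem (mul_mem (mem_sup_adjoin_left hx)
    (pow_mem (mem_sup_adjoin_self L β) j)) hz, ?_⟩
  rw [show y - ((x * β ^ j + z) ^ p - (x * β ^ j + z)) =
    (x ^ p * f ^ j - (x * β ^ j) ^ p) + (x * β ^ j + (y - x ^ p * f ^ j - (z ^ p - z))) by
      rw [add_pow_char]; ring]
  have hres : ((p * s - (p - 1) * b : ℤ) : ℝ) / ((p * N : ℕ) : ℝ) =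
      s / N - (p - 1) * (b / ((p * N : ℕ) : ℝ)) := by
    push_cast
    field_simp
  rw [v.map_add_eq_of_lt_left, h2, hres]
  rw [h2]
  refine (v.map_add _ _).trans_lt (max_lt ?_ (hzv.trans_lt ?_))
  · rw [h1, exp_lt_exp]
    exact hlt2
  · rw [exp_lt_exp, hcast]
    have h5 : ((s : ℝ) - 1) / N < s / N := by gcongr; linarith
    refine max_lt (by linarith) (lt_trans ?_ hlt2)
    gcongr

end Reduction

/-! ### How ramification numbers pass from `L` to `L(β)`. -/

section RamificationBreak

open WithZero

variable {K : Type*} [Field K] {E : Type*} [Field E] [Algebra K E] (v : Valuation E ℝᵐ⁰)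
  (L : IntermediateField K E) (N p : ℕ)

/-- `c` is the ramification number of `σ` on `L`, where `v` takes the values `exp (m / N)` on
`L^×`: `σ x / x - 1` has pole order at most `-c`, with equality if and only if `p ∤ v(x)`. -/
def HasRamBreak (σ : E →ₐ[K] E) (c : ℤ) : Prop :=
  ∀ x ∈ L, ∀ m : ℤ, v x = exp ((m : ℝ) / N) →
    (¬ (p : ℤ) ∣ m → v (σ x - x) = exp (((m - c : ℤ) : ℝ) / N)) ∧
    ((p : ℤ) ∣ m → v (σ x - x) < exp (((m - c : ℤ) : ℝ) / N))

variable {v L N p} [hp : Fact p.Prime]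

/-- Under `σ - 1` each term `x β ^ j` with `0 < j < p` shrinks by exactly the factor `ε`, and the
term `j = 0` by strictly more. The dominant term of `y` therefore decides, and its index is `0`
exactly when `p ∣ m`. -/
theorem TotRam.hasRamBreak_sup_adjoin [CharP E p] (hL : TotRam v L N) {β f : E} {b : ℤ}
    (hf : f ∈ L) (hβf : β ^ p - β = f) (hβ : v β = exp ((b : ℝ) / ((p * N : ℕ) : ℝ)))
    (hb : ¬ (p : ℤ) ∣ b) (σ : E →ₐ[K] E) (hσ : ∀ x, v (σ x) = v x) {c : ℤ} (hc : 0 < c)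
    (hσL : ∀ x ∈ L, x ≠ 0 → v (σ x - x) < v x * exp (-((c : ℝ) / ((p * N : ℕ) : ℝ))))
    (hσβ : v (σ β - β) = exp (((b - c : ℤ) : ℝ) / ((p * N : ℕ) : ℝ))) :
    HasRamBreak v (L ⊔ IntermediateField.adjoin K {β}) (p * N) p σ c := by
  have hN : (0 : ℝ) < N := by exact_mod_cast hL.pos
  have hp0 : (0 : ℝ) < p := by exact_mod_cast hp.out.pos
  have hpN : (0 : ℝ) < ((p * N : ℕ) : ℝ) := by push_cast; positivity
  have hβ0 : β ≠ 0 := by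
    rintro rfl
    rw [map_zero] at hβ
    exact exp_ne_zero hβ.symm
  set ε : ℝᵐ⁰ := exp (-((c : ℝ) / ((p * N : ℕ) : ℝ))) with hε
  have hε0 : 0 < ε := exp_pos
  set δ : E := (σ β - β) / β with hδ
  have hδv : v δ = ε := by
    rw [hδ, map_div₀, hσβ, hβ, ← exp_sub, hε, exp_inj]
    push_cast
    ring
  have hδ1 : v δ < 1 := by
    rw [hδv, hε, ← exp_zero, exp_lt_exp, neg_lt_zero]
    have : (0 : ℝ) < c := by exact_mod_cast hc
    positivity
  have hσβδ : σ β = β * (1 + δ) := by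
    rw [hδ]
    field_simp
    ring
  have hterm : ∀ x ∈ L, ∀ j < p,
      v (σ (x * β ^ j) - x * β ^ j) ≤ v (x * β ^ j) * ε ∧
      (x ≠ 0 → j = 0 → v (σ (x * β ^ j) - x * β ^ j) < v (x * β ^ j) * ε) ∧
      (x ≠ 0 → j ≠ 0 → v (σ (x * β ^ j) - x * β ^ j) = v (x * β ^ j) * ε) := by
    intro x hx j hj
    by_cases hx0 : x = 0
    · simp [hx0]
    have h1 : σ (x * β ^ j) - x * β ^ j =
        x * β ^ j * ((1 + δ) ^ j - 1) + (σ x - x) * (σ β) ^ j := by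
      rw [map_mul, map_pow, hσβδ, mul_pow]
      ring
    have h2 : v ((σ x - x) * (σ β) ^ j) < v (x * β ^ j) * ε := by
      rw [map_mul, map_mul, map_pow, map_pow, hσ, mul_right_comm]
      refine mul_lt_mul_of_pos_right (hσL x hx hx0) (pow_pos ?_ _)
      rw [hβ]
      exact exp_pos
    have hj0 : j = 0 → v (σ (x * β ^ j) - x * β ^ j) < v (x * β ^ j) * ε := by
      rintro rfl
      simpa using h2
    have hj1 : j ≠ 0 → v (σ (x * β ^ j) - x * β ^ j) = v (x * β ^ j) * ε := by
      intro hj0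
      have h3 : v (x * β ^ j * ((1 + δ) ^ j - 1)) = v (x * β ^ j) * ε := by
        rw [map_mul v (x * β ^ j), valuation_one_add_pow_sub_one_eq v hδ1, hδv]
        exact valuation_natCast_eq_one v p
          fun h => hj0 (Nat.eq_zero_of_dvd_of_lt h hj)
      rw [h1, v.map_add_eq_of_lt_left, h3]
      rwa [h3]
    refine ⟨?_, fun _ => hj0, fun _ => hj1⟩
    by_cases h : j = 0
    · exact (hj0 h).le
    · exact (hj1 h).le
  intro y hy m hym
  obtain ⟨x, hx, rfl⟩ := exists_eq_sum_of_mem_sup_adjoin hf hβf hy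
  obtain ⟨j, hj, hxj, hjv, hlt⟩ := hL.valuation_sum_pow hβ hb hx (by
    by_contra! h
    rw [Finset.sum_eq_zero fun k hk => by rw [h k (Finset.mem_range.1 hk), zero_mul],
      map_zero] at hym
    exact exp_ne_zero hym.symm)
  have hdvd := hL.eq_index_of_valuation_eq hβ (hx j) hxj (hjv.symm.trans hym)
  have hmj : (p : ℤ) ∣ m ↔ j = 0 := by
    constructor
    · intro h
      exact index_eq_of_dvd hb hj hp.out.pos hdvd (by simpa using h)
    · rintro rfl
      simpa using hdvd
  have hmε : exp (((m - c : ℤ) : ℝ) / ((p * N : ℕ) : ℝ)) = v (x j * β ^ j) * ε := by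
    rw [← hjv, hym, hε, ← exp_add, exp_inj]
    push_cast
    ring
  have hmεpos : 0 < v (x j * β ^ j) * ε := by rw [← hmε]; exact exp_pos
  have hsum : σ (∑ k ∈ Finset.range p, x k * β ^ k) - ∑ k ∈ Finset.range p, x k * β ^ k =
      (σ (x j * β ^ j) - x j * β ^ j) +
        ∑ k ∈ (Finset.range p).erase j, (σ (x k * β ^ k) - x k * β ^ k) := by
    rw [map_sum, ← Finset.sum_sub_distrib,
      Finset.add_sum_erase _ (fun k => σ (x k * β ^ k) - x k * β ^ k) (Finset.mem_range.2 hj)]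
  have hrest : v (∑ k ∈ (Finset.range p).erase j, (σ (x k * β ^ k) - x k * β ^ k)) <
      v (x j * β ^ j) * ε := by
    refine v.map_sum_lt hmεpos.ne' fun k hk => ?_
    have hkp := Finset.mem_range.1 (Finset.mem_of_mem_erase hk)
    refine (hterm (x k) (hx k) k hkp).1.trans_lt ?_
    exact mul_lt_mul_of_pos_right (hlt k hkp (Finset.ne_of_mem_erase hk)) hε0
  obtain ⟨-, h0, h1⟩ := hterm (x j) (hx j) j hj
  rw [hmε, hmj, hsum]
  constructor
  · intro hj0
    rw [v.map_add_eq_of_lt_left, h1 hxj hj0]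
    rwa [h1 hxj hj0]
  · intro hj0
    exact v.map_add_lt (h0 hxj hj0) hrest

/-- As `σ` fixes `f`, the difference `σ β - β` is a nonzero root of `T ^ p - T`, hence a unit. -/
theorem TotRam.hasRamBreak_of_fixes [CharP E p] (hL : TotRam v L N) {β f : E} {b : ℤ}
    (hf : f ∈ L) (hβf : β ^ p - β = f) (hβ : v β = exp ((b : ℝ) / ((p * N : ℕ) : ℝ)))
    (hb : ¬ (p : ℤ) ∣ b) (hb0 : 0 < b) (σ : E →ₐ[K] E) (hσ : ∀ x, v (σ x) = v x)
    (hσL : ∀ x ∈ L, σ x = x) (hσβ : σ β ≠ β) :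
    HasRamBreak v (L ⊔ IntermediateField.adjoin K {β}) (p * N) p σ b := by
  refine hL.hasRamBreak_sup_adjoin hf hβf hβ hb σ hσ hb0 ?_ ?_
  · intro x hx hx0
    rw [hσL x hx, sub_self, map_zero]
    exact mul_pos (zero_lt_iff.2 ((Valuation.ne_zero_iff v).2 hx0)) exp_pos
  · rw [sub_self, Int.cast_zero, zero_div, exp_zero]
    refine valuation_eq_one_of_pow_eq v (p := p) (sub_ne_zero.2 hσβ) ?_
    have h1 : σ (β ^ p - β) = β ^ p - β := by rw [hβf, hσL f hf]
    rw [map_sub, map_pow] at h1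
    rw [sub_pow_char]
    linear_combination h1

/-- The element `σ β - β` is an Artin-Schreier root of `σ f - f`. The latter has order exactly `b -
c > 0` in `L` since `p ∤ b`, which yields order `b - c` in `L(β)`. On `L` itself the relative shift
`c / N` exceeds the required `c / (p N)`. -/
theorem TotRam.hasRamBreak_of_hasRamBreak [CharP E p] (hL : TotRam v L N) {β f : E} {b : ℤ}
    (hf : f ∈ L) (hβf : β ^ p - β = f) (hβ : v β = exp ((b : ℝ) / ((p * N : ℕ) : ℝ)))
    (hb : ¬ (p : ℤ) ∣ b) (σ : E →ₐ[K] E) (hσ : ∀ x, v (σ x) = v x) {c : ℤ} (hc : 0 < c)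
    (hcb : c < b) (hσL : HasRamBreak v L N p σ c) :
    HasRamBreak v (L ⊔ IntermediateField.adjoin K {β}) (p * N) p σ c := by
  have hN : (0 : ℝ) < N := by exact_mod_cast hL.pos
  have hp0 : (0 : ℝ) < p := by exact_mod_cast hp.out.pos
  have hp1 : (1 : ℝ) < p := by exact_mod_cast hp.out.one_lt
  have hcr : (0 : ℝ) < c := by exact_mod_cast hc
  have hbc : (c : ℝ) < b := by exact_mod_cast hcb
  refine hL.hasRamBreak_sup_adjoin hf hβf hβ hb σ hσ hc ?_ ?_
  · intro x hx hx0
    obtain ⟨m, hm⟩ := hL.val x hx hx0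
    have hle : v (σ x - x) ≤ exp (((m - c : ℤ) : ℝ) / N) := by
      by_cases h : (p : ℤ) ∣ m
      · exact ((hσL x hx m hm).2 h).le
      · exact ((hσL x hx m hm).1 h).le
    refine hle.trans_lt ?_
    rw [hm, ← exp_add, exp_lt_exp]
    push_cast
    rw [← sub_pos]
    have : (m : ℝ) / N + -(c / (p * N)) - (m - c) / N = (p - 1) * c / (p * N) := by
      field_simp
      ring
    rw [this]
    have : (0 : ℝ) < p - 1 := by linarith
    positivity
  · have hfv : v f = exp ((b : ℝ) / N) := by
      rw [← hβf, v.map_sub_eq_of_lt_left]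
      · rw [map_pow, hβ, exp_real_pow, exp_inj]
        push_cast
        field_simp
      · rw [map_pow]
        refine lt_self_pow₀ ?_ hp.out.one_lt
        rw [hβ, ← exp_zero, exp_lt_exp]
        push_cast
        have : (0 : ℝ) < b := by linarith
        positivity
    have h1 := (hσL f hf b hfv).1 hb
    have h2 : (σ β - β) ^ p - (σ β - β) = σ f - f := by
      rw [sub_pow_char, ← hβf, map_sub, map_pow]
      ring
    rw [valuation_of_artinSchreier v _ h2 h1, exp_inj]
    · push_cast
      field_simp
    · push_cast
      have : (0 : ℝ) < b - c := by linarith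
      positivity

end RamificationBreak

/-! ### The induction along the tower. -/

section TowerInduction

open WithZero

/-- The numerical relations between the upper breaks `u_i` and the lower breaks `b_i`. -/
structure BreakData (p n : ℕ) (u : ℕ → ℕ) (b : ℕ → ℤ) : Prop where
  u_pos : ∀ i, 1 ≤ i → i ≤ n → 0 < u i
  u_lt : ∀ i, 1 ≤ i → i < n → u i < u (i + 1)
  u_not_dvd : ∀ i, 1 ≤ i → i ≤ n → ¬ p ∣ u i
  b_one : b 1 = u 1
  b_succ : ∀ i, 1 ≤ i → i < n → b (i + 1) - b i = (p : ℤ) ^ i * ((u (i + 1) : ℤ) - u i)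

namespace BreakData

variable {p n : ℕ} {u : ℕ → ℕ} {b : ℕ → ℤ}

theorem u_lt_of_lt (h : BreakData p n u b) {i j : ℕ} (hi : 1 ≤ i) (hij : i < j) (hj : j ≤ n) : u i < u j := by
  induction j, hij using Nat.le_induction with
  | base => exact h.u_lt i hi hj
  | succ k hk ih => exact (ih (by omega)).trans (h.u_lt k (by omega) hj)

theorem u_le_of_le (h : BreakData p n u b) {i j : ℕ} (hi : 1 ≤ i) (hij : i ≤ j) (hj : j ≤ n) : u i ≤ u j := by
  rcases hij.eq_or_lt with rfl | hlt
  · exact le_rfl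
  · exact (h.u_lt_of_lt hi hlt hj).le

theorem b_not_dvd (h : BreakData p n u b) {i : ℕ} (hi : 1 ≤ i) (hin : i ≤ n) : ¬ (p : ℤ) ∣ b i := by
  induction i, hi using Nat.le_induction with
  | base =>
    rw [h.b_one, Int.natCast_dvd_natCast]
    exact h.u_not_dvd 1 le_rfl hin
  | succ k hk ih =>
    intro hd
    apply ih (by omega)
    have h1 := h.b_succ k hk (by omega)
    have h2 : (p : ℤ) ∣ b (k + 1) - b k := by
      rw [h1]
      exact (dvd_pow_self _ (by omega)).mul_right _
    have := dvd_sub hd h2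
    rwa [sub_sub_cancel] at this

variable [hp : Fact p.Prime]

theorem b_lt (h : BreakData p n u b) {i : ℕ} (hi : 1 ≤ i) (hin : i < n) : b i < b (i + 1) := by
  have h1 := h.b_succ i hi hin
  have h2 : (u i : ℤ) < u (i + 1) := by exact_mod_cast h.u_lt i hi hin
  have h3 : (0 : ℤ) < (p : ℤ) ^ i := pow_pos (by exact_mod_cast hp.out.pos) _
  have : 0 < (p : ℤ) ^ i * ((u (i + 1) : ℤ) - u i) := mul_pos h3 (by linarith)
  linarith

theorem b_lt_of_lt (h : BreakData p n u b) {i j : ℕ} (hi : 1 ≤ i) (hij : i < j) (hj : j ≤ n) : b i < b j := by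
  induction j, hij using Nat.le_induction with
  | base => exact h.b_lt hi hj
  | succ k hk ih => exact (ih (by omega)).trans (h.b_lt (by omega) hj)

theorem b_pos (h : BreakData p n u b) {i : ℕ} (hi : 1 ≤ i) (hin : i ≤ n) : 0 < b i := by
  have h1 : 0 < b 1 := by
    rw [h.b_one]
    exact_mod_cast h.u_pos 1 le_rfl (hi.trans hin)
  rcases hi.eq_or_lt with rfl | hlt
  · exact h1
  · exact h1.trans (h.b_lt_of_lt le_rfl hlt hin)

/-- Needed to see that a bound by `b (i + 1)` on the pole of `d (i + 1)` in `K_i` makes it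
negligible against `a (i + 1)`, whose pole order there is `p ^ i * u (i + 1)`. -/
theorem b_le (h : BreakData p n u b) {i : ℕ} (hin : i < n) : b (i + 1) ≤ (p : ℤ) ^ i * u (i + 1) := by
  induction i with
  | zero =>
    rw [zero_add, h.b_one]
    simp
  | succ k ih =>
    have h1 := h.b_succ (k + 1) (by omega) hin
    have h2 := ih (by omega)
    have h3 : (p : ℤ) ^ k * u (k + 1) ≤ (p : ℤ) ^ (k + 1) * u (k + 1) := by
      gcongr
      · exact_mod_cast hp.out.one_le
      · omega
    linarith [mul_sub ((p : ℤ) ^ (k + 1)) (u (k + 1 + 1) : ℤ) (u (k + 1) : ℤ)]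

end BreakData

variable {K : Type*} [Field K] {E : Type*} [Field E] [Algebra K E] (v : Valuation E ℝᵐ⁰)
  (α : ℕ → E) (b : ℕ → ℤ) (p : ℕ)

variable (K) in
/-- `K_{i+1} / K_i` is generated by an Artin-Schreier root with pole order `b_{i+1}`. -/
def HasReducedGenerator (i : ℕ) : Prop :=
  ∃ β f : E, f ∈ tower K α i ∧ β ^ p - β = f ∧
    v β = exp ((b (i + 1) : ℝ) / ((p * p ^ i : ℕ) : ℝ)) ∧
    tower K α (i + 1) = tower K α i ⊔ IntermediateField.adjoin K {β}

variable {v α b p} [hp : Fact p.Prime] [CharP E p] {n : ℕ} {u : ℕ → ℕ}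

/-- The intermediate field on which two homomorphisms agree. -/
def equalizerField (φ ψ : E →ₐ[K] E) : IntermediateField K E :=
  (AlgHom.equalizer φ ψ).toIntermediateField fun x hx => by
    rw [AlgHom.mem_equalizer] at hx ⊢
    rw [map_inv₀, map_inv₀, hx]

theorem mem_equalizerField {φ ψ : E →ₐ[K] E} {x : E} : x ∈ equalizerField φ ψ ↔ φ x = ψ x :=
  Iff.rfl

theorem sup_adjoin_sub_eq (L : IntermediateField K E) {x z : E} (hz : z ∈ L) :
    L ⊔ IntermediateField.adjoin K {x} = L ⊔ IntermediateField.adjoin K {x - z} := by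
  apply le_antisymm
  · refine sup_le le_sup_left ?_
    rw [IntermediateField.adjoin_simple_le_iff]
    have := add_mem (mem_sup_adjoin_self L (x - z)) (mem_sup_adjoin_left (β := x - z) hz)
    rwa [sub_add_cancel] at this
  · refine sup_le le_sup_left ?_
    rw [IntermediateField.adjoin_simple_le_iff]
    exact sub_mem (mem_sup_adjoin_self L x) (mem_sup_adjoin_left hz)

theorem tower_mono : Monotone (tower K α) :=
  monotone_nat_of_le_succ fun _ => le_sup_left

theorem gen_mem_tower {i j : ℕ} (hi : 1 ≤ i) (hij : i ≤ j) : α i ∈ tower K α j := by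
  refine tower_mono hij ?_
  obtain ⟨k, rfl⟩ : ∃ k, i = k + 1 := ⟨i - 1, by omega⟩
  exact mem_sup_adjoin_self _ _

/-- The exponent is the value at `u (i + 1)` of the inverse Herbrand function of `K_j / K`. One
application of `s ↦ p s - (p - 1) b` takes the exponent for `j` to that for `j + 1`, and at `j = i`
only `b (i + 1)` is left. -/
theorem exists_reduction_in_tower (h : BreakData p n u b)
    (hperf : ∀ c : K, v (algebraMap K E c) ≤ 1 → ∃ d : K, v (algebraMap K E (d ^ p - c)) < 1)
    {i : ℕ} (hin : i < n) (hram : ∀ j ≤ i, TotRam v (tower K α j) (p ^ j))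
    (hgen : ∀ j < i, HasReducedGenerator K v α b p j) {a : K}
    (ha : v (algebraMap K E a) = exp (u (i + 1) : ℝ)) {j : ℕ} (hj : j ≤ i) :
    ∃ z ∈ tower K α j, v (algebraMap K E a - (z ^ p - z)) =
      exp (((b (j + 1) + p ^ j * ((u (i + 1) : ℤ) - u (j + 1)) : ℤ) : ℝ) / ((p ^ j : ℕ) : ℝ)) := by
  induction j with
  | zero =>
    refine ⟨0, zero_mem _, ?_⟩
    rw [zero_pow hp.out.ne_zero, sub_zero, sub_zero, ha, exp_inj, zero_add, h.b_one]
    push_cast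
    simp
  | succ j ih =>
    obtain ⟨z, hz, hzv⟩ := ih (by omega)
    obtain ⟨β, f, hf, hβf, hβ, htow⟩ := hgen j (by omega)
    -- For `j = 0` the number is `u (i + 1)`; for `j > 0` it is congruent to `b (j + 1)` modulo `p`.
    have hps : ¬ (p : ℤ) ∣ b (j + 1) + p ^ j * ((u (i + 1) : ℤ) - u (j + 1)) := by
      rcases Nat.eq_zero_or_pos j with rfl | hj0
      · rw [zero_add, h.b_one, pow_zero, one_mul, add_sub_cancel, Int.natCast_dvd_natCast]
        exact h.u_not_dvd _ (by omega) (by omega)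
      · intro hd
        refine h.b_not_dvd (i := j + 1) (by omega) (by omega) ?_
        exact (dvd_add_left ((dvd_pow_self _ (by omega)).mul_right _)).1 hd
    have hsb : b (j + 1) < b (j + 1) + p ^ j * ((u (i + 1) : ℤ) - u (j + 1)) := by
      have h1 : (u (j + 1) : ℤ) < u (i + 1) := by
        exact_mod_cast h.u_lt_of_lt (by omega) (by omega) (by omega)
      have h2 : (0 : ℤ) < (p : ℤ) ^ j := pow_pos (by exact_mod_cast hp.out.pos) _
      have : 0 < (p : ℤ) ^ j * ((u (i + 1) : ℤ) - u (j + 1)) := mul_pos h2 (by linarith)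
      linarith
    obtain ⟨w, hw, hwv⟩ := (hram j (by omega)).exists_sub_artinSchreier_eq hperf hf hβf hβ
      (h.b_not_dvd (by omega) (by omega)) (h.b_pos (by omega) (by omega)) hsb hps
      (sub_mem ((tower K α j).algebraMap_mem a) (sub_mem (pow_mem hz p) hz)) hzv
    rw [← htow] at hw
    refine ⟨z + w, add_mem (tower_mono (Nat.le_succ j) hz) hw, ?_⟩
    rw [show algebraMap K E a - ((z + w) ^ p - (z + w)) =
      algebraMap K E a - (z ^ p - z) - (w ^ p - w) by rw [add_pow_char]; ring, hwv, exp_inj]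
    have h3 := h.b_succ (j + 1) (by omega) (by omega)
    rw [show (p * p ^ j : ℕ) = p ^ (j + 1) by ring]
    congr 2
    linear_combination -h3

/-- The field `K_{i+1}` is generated over `K_i` by `α (i + 1) - z`, with `z` reducing `a (i + 1)`;
the bound on `d` keeps it from disturbing the pole. That bound is assumed conditionally because it
depends on the valuations of the earlier `α j`, which the same induction supplies. -/
theorem totRam_tower (h : BreakData p n u b)
    (hperf : ∀ c : K, v (algebraMap K E c) ≤ 1 → ∃ d : K, v (algebraMap K E (d ^ p - c)) < 1)
    (hbot : TotRam v (⊥ : IntermediateField K E) 1) {a : ℕ → K}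
    (ha : ∀ i, 1 ≤ i → i ≤ n → v (algebraMap K E (a i)) = exp (u i : ℝ)) {d : ℕ → E}
    (hα : ∀ i, 1 ≤ i → i ≤ n → α i ^ p - α i = d i + algebraMap K E (a i))
    (hdmem : ∀ i < n, d (i + 1) ∈ tower K α i)
    (hdv : ∀ i < n, (∀ j, 1 ≤ j → j ≤ i → v (α j) = exp ((u j : ℝ) / p)) →
      v (d (i + 1)) < exp ((b (i + 1) : ℝ) / ((p ^ i : ℕ) : ℝ))) {i : ℕ} (hi : i ≤ n) :
    (∀ j ≤ i, TotRam v (tower K α j) (p ^ j)) ∧ (∀ j < i, HasReducedGenerator K v α b p j) ∧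
      ∀ j, 1 ≤ j → j ≤ i → v (α j) = exp ((u j : ℝ) / p) := by
  have hp0 : (0 : ℝ) < p := by exact_mod_cast hp.out.pos
  induction i with
  | zero =>
    refine ⟨fun j hj => ?_, fun j hj => absurd hj (by omega), fun j h1 hj => absurd hj (by omega)⟩
    obtain rfl : j = 0 := by omega
    rw [pow_zero]
    exact hbot
  | succ i ih =>
    obtain ⟨hram, hgen, hval⟩ := ih (by omega)
    have hdi := hdv i (by omega) hval
    have hai := ha (i + 1) (by omega) hi
    have hαi := hα (i + 1) (by omega) hi
    have hbpos : (0 : ℝ) < b (i + 1) := by exact_mod_cast h.b_pos (i := i + 1) (by omega) hi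
    have hvα : v (α (i + 1)) = exp ((u (i + 1) : ℝ) / p) := by
      refine valuation_of_artinSchreier v ?_ hαi ?_
      · exact_mod_cast h.u_pos (i + 1) (by omega) hi
      · rw [v.map_add_eq_of_lt_right, hai]
        rw [hai]
        refine hdi.trans_le (exp_le_exp.2 ?_)
        push_cast
        rw [div_le_iff₀ (by positivity), mul_comm]
        exact_mod_cast h.b_le (i := i) (by omega)
    obtain ⟨z, hz, hzv⟩ := exists_reduction_in_tower h hperf (by omega) hram hgen hai le_rfl
    rw [sub_self, mul_zero, add_zero] at hzv
    have hfmem : d (i + 1) + (algebraMap K E (a (i + 1)) - (z ^ p - z)) ∈ tower K α i :=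
      add_mem (hdmem i (by omega))
        (sub_mem ((tower K α i).algebraMap_mem _) (sub_mem (pow_mem hz p) hz))
    have hβf : (α (i + 1) - z) ^ p - (α (i + 1) - z) =
        d (i + 1) + (algebraMap K E (a (i + 1)) - (z ^ p - z)) := by
      rw [sub_pow_char]
      linear_combination hαi
    have hβ : v (α (i + 1) - z) = exp ((b (i + 1) : ℝ) / ((p * p ^ i : ℕ) : ℝ)) := by
      rw [valuation_of_artinSchreier v (r := (b (i + 1) : ℝ) / ((p ^ i : ℕ) : ℝ)) ?_ hβf ?_]
      · rw [exp_inj]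
        push_cast
        field_simp
      · push_cast
        positivity
      · rw [v.map_add_eq_of_lt_right, hzv]
        rwa [hzv]
    have htow : tower K α (i + 1) =
        tower K α i ⊔ IntermediateField.adjoin K {α (i + 1) - z} := sup_adjoin_sub_eq _ hz
    refine ⟨fun j hj => ?_, fun j hj => ?_, fun j h1 hj => ?_⟩
    · rcases Nat.lt_or_eq_of_le hj with hlt | rfl
      · exact hram j (by omega)
      · rw [htow, pow_succ']
        exact (hram i le_rfl).sup_adjoin hfmem hβf hβ (h.b_not_dvd (by omega) hi)
    · rcases Nat.lt_or_eq_of_le (Nat.lt_succ_iff.1 hj) with hlt | rfl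
      · exact hgen j hlt
      · exact ⟨_, _, hfmem, hβf, hβ, htow⟩
    · rcases Nat.lt_or_eq_of_le hj with hlt | rfl
      · exact hval j h1 (by omega)
      · exact hvα

/-- An automorphism that fixes `K_i` but not `K_{i+1}` has ramification number `b_{i+1}` on
all the fields `K_k` with `k > i`. -/
theorem hasRamBreak_tower (h : BreakData p n u b)
    (hram : ∀ j ≤ n, TotRam v (tower K α j) (p ^ j))
    (hgen : ∀ j < n, HasReducedGenerator K v α b p j) (σ : E →ₐ[K] E)
    (hσ : ∀ x, v (σ x) = v x) {i k : ℕ} (hfix : ∀ x ∈ tower K α i, σ x = x)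
    (hmove : ∃ x ∈ tower K α (i + 1), σ x ≠ x) (hik : i < k) (hk : k ≤ n) :
    HasRamBreak v (tower K α k) (p ^ k) p σ (b (i + 1)) := by
  induction k, hik using Nat.le_induction with
  | base =>
    obtain ⟨β, f, hf, hβf, hβ, htow⟩ := hgen i hk
    have hmoveβ : σ β ≠ β := by
      intro hσβ
      obtain ⟨x, hx, hσx⟩ := hmove
      apply hσx
      have hle : tower K α (i + 1) ≤ equalizerField σ (AlgHom.id K E) := by
        rw [htow]
        refine sup_le (fun y hy => ?_) (IntermediateField.adjoin_simple_le_iff.2 ?_)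
        · exact mem_equalizerField.2 (hfix y hy)
        · exact mem_equalizerField.2 hσβ
      exact mem_equalizerField.1 (hle hx)
    change HasRamBreak v (tower K α (i + 1)) (p ^ (i + 1)) p σ (b (i + 1))
    rw [htow, pow_succ']
    exact (hram i (by omega)).hasRamBreak_of_fixes hf hβf hβ (h.b_not_dvd (by omega) hk)
      (h.b_pos (by omega) hk) σ hσ hfix hmoveβ
  | succ k hik ih =>
    obtain ⟨β, f, hf, hβf, hβ, htow⟩ := hgen k hk
    rw [htow, pow_succ']
    exact (hram k (by omega)).hasRamBreak_of_hasRamBreak hf hβf hβ (h.b_not_dvd (by omega) hk)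
      σ hσ (h.b_pos (by omega) (by omega)) (h.b_lt_of_lt (by omega) (by omega) hk) (ih (by omega))

end TowerInduction

/-! ### Automorphisms of the generic extension. -/

section GenericSystem

/-- In the fraction field the roots of `T ^ p - T` form the prime field. -/
theorem exists_natCast_eq_of_pow_eq {A : Type*} [CommRing A] [IsDomain A] (p : ℕ) [Fact p.Prime]
    [CharP A p] {δ : A} (h : δ ^ p = δ) : ∃ k : ℕ, δ = k := by
  have : CharP (FractionRing A) p :=
    charP_of_injective_algebraMap (IsFractionRing.injective A (FractionRing A)) p
  have h1 : algebraMap A (FractionRing A) δ ∈ (⊥ : Subfield (FractionRing A)) := by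
    rw [Subfield.mem_bot_iff_pow_eq_self _ p, ← map_pow, h]
  rw [← ZMod.fieldRange_castHom_eq_bot p] at h1
  obtain ⟨c, hc⟩ := h1
  refine ⟨c.val, IsFractionRing.injective A (FractionRing A) ?_⟩
  rw [map_natCast, ← hc, ← map_natCast (ZMod.castHom dvd_rfl (FractionRing A)),
    ZMod.natCast_zmod_val]

variable {p : ℕ}

/-- The variable `Y_j` as an element of `S_i`. -/
def genVar (p i j : ℕ) (hj : j ∈ Set.Icc 1 i) : genS p i :=
  ⟨MvPolynomial.X j, Algebra.subset_adjoin ⟨j, hj, rfl⟩⟩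

theorem ringHom_genS_ext {A : Type*} [CommRing A] {i : ℕ} {φ ψ : genS p i →+* A}
    (h : ∀ j (hj : j ∈ Set.Icc 1 i), φ (genVar p i j hj) = ψ (genVar p i j hj)) : φ = ψ := by
  have key : ∀ x (hx : x ∈ Algebra.adjoin (ZMod p) (MvPolynomial.X '' Set.Icc 1 i)),
      φ ⟨x, hx⟩ = ψ ⟨x, hx⟩ := by
    intro x hx
    induction hx using Algebra.adjoin_induction with
    | mem x hx =>
      obtain ⟨j, hj, rfl⟩ := hx
      exact h j hj
    | algebraMap r =>
      exact DFunLike.congr_fun (Subsingleton.elim (φ.comp (algebraMap (ZMod p) (genS p i)))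
        (ψ.comp (algebraMap (ZMod p) (genS p i)))) r
    | add x y hx hy ihx ihy =>
      have h1 := congrArg₂ (· + ·) ihx ihy
      simp only [← map_add] at h1
      exact h1
    | mul x y hx hy ihx ihy =>
      have h1 := congrArg₂ (· * ·) ihx ihy
      simp only [← map_mul] at h1
      exact h1
  exact RingHom.ext fun x => key x.1 x.2

/-- The inclusion `S_i ⊆ S_j` for `i ≤ j`. -/
theorem genS_mono {i j : ℕ} (h : i ≤ j) : genS p i ≤ genS p j :=
  MvPolynomial.supported_mono (Set.Icc_subset_Icc_right h)

/-- The automorphism `σ` of `S_j` restricts to the automorphism `τ` of `S_i`. -/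
def RestrictsTo {i j : ℕ} (σ : genS p j ≃+* genS p j) (τ : genS p i ≃+* genS p i) : Prop :=
  ∀ (x : genS p i) (y : genS p j), (x : MvPolynomial ℕ (ZMod p)) = y →
    ((τ x : genS p i) : MvPolynomial ℕ (ZMod p)) = σ y

variable {n : ℕ} {G : Type*} [Group G] {F : PFilteredGroup p n G}
  {D : ℕ → MvPolynomial ℕ (ZMod p)}

theorem IsGenericSystem.mem_genS (hD : IsGenericSystem F D) {i : ℕ} (hi : i + 1 ≤ n) :
    D (i + 1) ∈ genS p i := by
  refine MvPolynomial.supported_mono ?_ (hD.mem_supported (i + 1) (by omega) hi)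
  intro j hj
  exact ⟨hj.1, Nat.lt_succ_iff.1 hj.2⟩

theorem IsGenericSystem.genX_mem_genS (hD : IsGenericSystem F D) {i : ℕ} (hi : i + 1 ≤ n) :
    genX D (i + 1) ∈ genS p (i + 1) := by
  have h : (MvPolynomial.X (i + 1) : MvPolynomial ℕ (ZMod p)) ∈ genS p (i + 1) :=
    (genVar p (i + 1) (i + 1) ⟨by omega, le_rfl⟩).2
  exact sub_mem (sub_mem (pow_mem h p) h) (genS_mono (Nat.le_succ i) (hD.mem_genS hi))

theorem genGal_apply_genX {i j : ℕ} {σ : genS p i ≃+* genS p i}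
    (hσ : σ ∈ genGal D i) (hj : j ∈ Set.Icc 1 i) (hX : genX D j ∈ genS p i) :
    σ ⟨genX D j, hX⟩ = ⟨genX D j, hX⟩ :=
  (mem_fixingSubgroup_iff _).1 hσ _ (Algebra.subset_adjoin ⟨j, hj, rfl⟩)

theorem genS_apply_X {i : ℕ} (σ : genS p (i + 1) ≃+* genS p (i + 1))
    (hσ : σ ∈ genGal D (i + 1)) (hX : genX D (i + 1) ∈ genS p (i + 1))
    (hDm : D (i + 1) ∈ genS p (i + 1)) (hi : i + 1 ∈ Set.Icc 1 (i + 1)) :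
    σ (genVar p (i + 1) (i + 1) hi) ^ p - σ (genVar p (i + 1) (i + 1) hi) - σ ⟨D (i + 1), hDm⟩ =
      ⟨genX D (i + 1), hX⟩ := by
  rw [← map_pow, ← map_sub, ← map_sub]
  exact genGal_apply_genX hσ hi hX

section Evaluation

variable {K : Type*} [Field K] [CharP K p] {E : Type*} [Field E] [Algebra K E]

variable (K) in
/-- Evaluation at `α`, as a ring homomorphism `S_i → E`. -/
def evS (α : ℕ → E) (i : ℕ) : genS p i →+* E :=
  (MvPolynomial.eval₂Hom ((algebraMap K E).comp (ZMod.castHom (dvd_refl p) K)) α).comp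
    (genS p i).val.toRingHom

theorem evS_apply (α : ℕ → E) (i : ℕ) (x : genS p i) : evS K α i x = evalAt K α x.1 := rfl

theorem evS_genVar (α : ℕ → E) {i j : ℕ} (hj : j ∈ Set.Icc 1 i) :
    evS K α i (genVar p i j hj) = α j :=
  MvPolynomial.eval₂_X _ _ _

theorem evalAt_genX (α : ℕ → E) (D : ℕ → MvPolynomial ℕ (ZMod p)) (j : ℕ) :
    evalAt K α (genX D j) = α j ^ p - α j - evalAt K α (D j) := by
  have h : ∀ P, evalAt K α P =
    MvPolynomial.eval₂Hom ((algebraMap K E).comp (ZMod.castHom (dvd_refl p) K)) α P := fun _ => rfl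
  rw [h, h, genX, map_sub, map_sub, map_pow, MvPolynomial.eval₂Hom_X']

/-- `β` agrees with the values at `α` of the conjugates under `σ` of the variables. -/
theorem evalAt_eq_of_genVar {α β : ℕ → E} {i : ℕ} {σ : genS p i ≃+* genS p i}
    (h : ∀ j (hj : j ∈ Set.Icc 1 i), β j = evS K α i (σ (genVar p i j hj))) (x : genS p i) :
    evalAt K β x.1 = evS K α i (σ x) := by
  have : evS K β i = (evS K α i).comp (σ : genS p i →+* genS p i) := by
    refine ringHom_genS_ext fun j hj => ?_
    rw [evS_genVar, h j hj]
    rfl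
  exact DFunLike.congr_fun this x

end Evaluation

theorem IsGenericSystem.exists_lift (hD : IsGenericSystem F D) :
    ∃ lam : ∀ i, i ≤ n → (genGal D i ≃* G ⧸ F.sub i), ∀ (i j : ℕ) (hij : i ≤ j) (hj : j ≤ n),
      (∀ σ : genGal D j, ∃ τ : genGal D i, RestrictsTo σ.1 τ.1 ∧
        lam i (hij.trans hj) τ = F.proj hij (lam j hj σ)) := by
  obtain ⟨lam, hlam⟩ := hD.exists_iso
  refine ⟨lam, fun i j hij hj => ?_⟩
  induction j, hij using Nat.le_induction with
  | base =>
    refine fun σ => ⟨σ, fun x y hxy => ?_, ?_⟩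
    · rw [Subtype.ext hxy]
    · obtain ⟨g, hg⟩ := QuotientGroup.mk_surjective (lam i hj σ)
      rw [← hg]
      rfl
  | succ j hij ih =>
    intro σ
    obtain ⟨τ, hτ, hτl⟩ := hlam j hj σ
    obtain ⟨ρ, hρ, hρl⟩ := ih (by omega) τ
    refine ⟨ρ, fun x y hxy => ?_, ?_⟩
    · rw [hρ x ⟨x.1, genS_mono hij x.2⟩ rfl]
      exact hτ _ y hxy
    · rw [hρl, hτl]
      obtain ⟨g, hg⟩ := QuotientGroup.mk_surjective (lam (j + 1) hj σ)
      rw [← hg]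
      rfl

/-- Restriction corresponds to the surjection `G / G_(i+1) → G / G_(i)`. -/
theorem IsGenericSystem.exists_restrictsTo (hD : IsGenericSystem F D) {i : ℕ} (hi : i + 1 ≤ n)
    (τ : genGal D i) : ∃ σ : genGal D (i + 1), RestrictsTo σ.1 τ.1 := by
  obtain ⟨lam, hlam⟩ := hD.exists_lift
  obtain ⟨g, hg⟩ := QuotientGroup.mk_surjective (lam i (by omega) τ)
  obtain ⟨τ', hτ', hl⟩ := hlam i (i + 1) (Nat.le_succ i) hi
    ((lam (i + 1) hi).symm (QuotientGroup.mk g))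
  rw [MulEquiv.apply_symm_apply] at hl
  have : τ' = τ := (lam i (by omega)).injective (by rw [hl, ← hg]; rfl)
  rw [this] at hτ'
  exact ⟨_, hτ'⟩

variable [hp : Fact p.Prime]

/-- Take `κ` corresponding to an element of `G_(i)` outside `G_(i+1)`. It fixes `S_i`, hence
`D_{i+1}`, and it fixes `X_{i+1}`; so it moves `Y_{i+1}` by a constant of `𝔽_p`, nonzero because `κ
≠ 1`. -/
theorem IsGenericSystem.exists_translation (hD : IsGenericSystem F D) {i : ℕ} (hi : i + 1 ≤ n) :
    ∃ κ ∈ genGal D (i + 1), RestrictsTo κ (1 : genS p i ≃+* genS p i) ∧ ∃ k : ℕ, ¬ p ∣ k ∧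
      ∀ h, κ (genVar p (i + 1) (i + 1) h) = genVar p (i + 1) (i + 1) h + k := by
  obtain ⟨lam, hlam⟩ := hD.exists_lift
  obtain ⟨g, hg, hg'⟩ : ∃ g ∈ F.sub i, g ∉ F.sub (i + 1) := by
    by_contra! hle
    have h1 : F.sub (i + 1) = F.sub i := le_antisymm (F.anti (Nat.le_succ i)) hle
    have h2 := F.card_sub i
    rw [← h1, F.card_sub] at h2
    have := Nat.pow_right_injective hp.out.two_le h2
    omega
  set κ := (lam (i + 1) hi).symm (QuotientGroup.mk g) with hκ
  obtain ⟨τ, hτ, hl⟩ := hlam i (i + 1) (Nat.le_succ i) hi κ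
  have hτ1 : τ = 1 := by
    apply (lam i (by omega)).injective
    rw [hl, hκ, MulEquiv.apply_symm_apply, map_one]
    exact (QuotientGroup.eq_one_iff _).2 hg
  have hκ1 : κ ≠ 1 := by
    intro h
    apply hg'
    rw [← QuotientGroup.eq_one_iff, ← (lam (i + 1) hi).apply_symm_apply (QuotientGroup.mk g), ← hκ,
      h, map_one]
  rw [hτ1] at hτ
  have hmem : i + 1 ∈ Set.Icc 1 (i + 1) := ⟨by omega, le_rfl⟩
  have hDm : D (i + 1) ∈ genS p (i + 1) := genS_mono (Nat.le_succ i) (hD.mem_genS hi)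
  have hκD : κ.1 ⟨D (i + 1), hDm⟩ = ⟨D (i + 1), hDm⟩ :=
    Subtype.ext (hτ ⟨D (i + 1), hD.mem_genS hi⟩ ⟨D (i + 1), hDm⟩ rfl).symm
  have : CharP (genS p (i + 1)) p :=
    charP_of_injective_algebraMap (algebraMap (ZMod p) (genS p (i + 1))).injective p
  have h1 := genS_apply_X κ.1 κ.2 (hD.genX_mem_genS hi) hDm hmem
  have h2 := genS_apply_X (D := D) 1 (one_mem _) (hD.genX_mem_genS hi) hDm hmem
  rw [hκD] at h1
  simp only [RingAut.one_apply] at h2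
  obtain ⟨k, hk⟩ := exists_natCast_eq_of_pow_eq p
    (δ := κ.1 (genVar p (i + 1) (i + 1) hmem) - genVar p (i + 1) (i + 1) hmem) (by
      rw [sub_pow_char]
      linear_combination h1 - h2)
  rw [sub_eq_iff_eq_add'] at hk
  refine ⟨κ.1, κ.2, hτ, k, fun hdvd => hκ1 ?_, fun _ => hk⟩
  rw [(CharP.cast_eq_zero_iff (genS p (i + 1)) p k).2 hdvd, add_zero] at hk
  apply Subtype.ext
  have h3 : (κ.1 : genS p (i + 1) →+* genS p (i + 1)) = RingHom.id _ := by
    refine ringHom_genS_ext fun j hj => ?_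
    rcases Nat.lt_or_eq_of_le hj.2 with hlt | rfl
    · exact Subtype.ext (hτ (genVar p i j ⟨hj.1, by omega⟩) (genVar p (i + 1) j hj) rfl).symm
    · exact hk
  exact RingEquiv.ext fun x => DFunLike.congr_fun h3 x

end GenericSystem

/-! ### The Galois group of the tower. -/

section GaloisGroup

variable {p : ℕ} [hp : Fact p.Prime] {n : ℕ} {G : Type*} [Group G] {F : PFilteredGroup p n G}
  {D : ℕ → MvPolynomial ℕ (ZMod p)} {K : Type*} [Field K] [CharP K p] {E : Type*} [Field E]
  [Algebra K E]

/-- Every solution of the system satisfied by `α` is obtained from `α` by an automorphism of the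
generic extension. -/
theorem IsGenericSystem.exists_genGal_of_solution [CharP E p] (hD : IsGenericSystem F D)
    {α β : ℕ → E} {i : ℕ} (hi : i ≤ n)
    (hβ : ∀ j, 1 ≤ j → j ≤ i → evalAt K β (genX D j) = evalAt K α (genX D j)) :
    ∃ σ ∈ genGal D i, ∀ j (hj : j ∈ Set.Icc 1 i), β j = evS K α i (σ (genVar p i j hj)) := by
  induction i with
  | zero => exact ⟨1, one_mem _, fun j hj => absurd (hj.1.trans hj.2) (by omega)⟩
  | succ i ih =>
    obtain ⟨τ, hτ, hτβ⟩ := ih (by omega) fun j h1 h2 => hβ j h1 (by omega)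
    obtain ⟨⟨σ, hσ⟩, hστ⟩ := hD.exists_restrictsTo hi ⟨τ, hτ⟩
    obtain ⟨κ, hκ, hκ1, k, hk, hκX⟩ := hD.exists_translation hi
    have hmem : i + 1 ∈ Set.Icc 1 (i + 1) := ⟨by omega, le_rfl⟩
    have hDm : D (i + 1) ∈ genS p (i + 1) := genS_mono (Nat.le_succ i) (hD.mem_genS hi)
    have hκX' : ∀ m : ℕ, (κ ^ m) (genVar p (i + 1) (i + 1) hmem) =
        genVar p (i + 1) (i + 1) hmem + ((m * k : ℕ) : genS p (i + 1)) := by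
      intro m
      induction m with
      | zero => simp
      | succ m ihm =>
        rw [pow_succ', RingAut.mul_apply, ihm, map_add, hκX, map_natCast]
        push_cast
        ring
    have hκY : ∀ (m : ℕ) (j : ℕ) (hj : j ∈ Set.Icc 1 i) (hj' : j ∈ Set.Icc 1 (i + 1)),
        (κ ^ m) (genVar p (i + 1) j hj') = genVar p (i + 1) j hj' := by
      intro m j hj hj'
      induction m with
      | zero => simp
      | succ m ihm =>
        rw [pow_succ', RingAut.mul_apply, ihm]
        exact Subtype.ext (hκ1 (genVar p i j hj) (genVar p (i + 1) j hj') rfl).symm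
    -- Any lift `σ` of `τ` yields a root `γ` of the Artin-Schreier equation satisfied by `β (i +
    -- 1)`. The two differ by a constant, which a power of the translation `κ` corrects.
    set γ := evS K α (i + 1) (σ (genVar p (i + 1) (i + 1) hmem)) with hγ
    have h1 : γ ^ p - γ - evS K α (i + 1) (σ ⟨D (i + 1), hDm⟩) = evalAt K α (genX D (i + 1)) := by
      rw [hγ, ← map_pow, ← map_sub, ← map_sub,
        genS_apply_X σ hσ (hD.genX_mem_genS hi) hDm hmem]
      rfl
    have h2 : evS K α (i + 1) (σ ⟨D (i + 1), hDm⟩) = evalAt K β (D (i + 1)) := by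
      rw [evalAt_eq_of_genVar hτβ ⟨D (i + 1), hD.mem_genS hi⟩, evS_apply, evS_apply]
      exact congrArg _ (hστ ⟨D (i + 1), hD.mem_genS hi⟩ ⟨D (i + 1), hDm⟩ rfl).symm
    have h3 := hβ (i + 1) (by omega) le_rfl
    rw [evalAt_genX] at h3
    obtain ⟨c, hc⟩ := exists_natCast_eq_of_pow_eq p (δ := β (i + 1) - γ) (by
      rw [sub_pow_char]
      linear_combination h3 - h1 - h2)
    obtain ⟨m, hm⟩ : ∃ m : ℕ, ((m * k : ℕ) : ZMod p) = c := by
      have hk0 : (k : ZMod p) ≠ 0 := fun h => hk ((CharP.cast_eq_zero_iff (ZMod p) p k).1 h)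
      refine ⟨((c : ZMod p) / k).val, ?_⟩
      rw [Nat.cast_mul, ZMod.natCast_zmod_val, div_mul_cancel₀ _ hk0]
    refine ⟨σ * κ ^ m, mul_mem hσ (pow_mem hκ m), fun j hj => ?_⟩
    rw [RingAut.mul_apply]
    rcases Nat.lt_or_eq_of_le hj.2 with hlt | rfl
    · have hj' : j ∈ Set.Icc 1 i := ⟨hj.1, by omega⟩
      rw [hκY m j hj' hj, hτβ j hj', evS_apply, evS_apply]
      exact congrArg _ (hστ (genVar p i j hj') (genVar p (i + 1) j hj) rfl)
    · rw [hκX', map_add, map_add, map_natCast, map_natCast, ← hγ, ← sub_eq_iff_eq_add', hc,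
        CharP.natCast_eq_natCast E p, ← ZMod.natCast_eq_natCast_iff, hm]

theorem evalAt_mem_tower {α : ℕ → E} {i : ℕ} (x : genS p i) : evalAt K α x.1 ∈ tower K α i := by
  obtain ⟨x, hx⟩ := x
  change x ∈ Algebra.adjoin (ZMod p) (MvPolynomial.X '' Set.Icc 1 i) at hx
  have h : ∀ P, evalAt K α P =
    MvPolynomial.eval₂Hom ((algebraMap K E).comp (ZMod.castHom (dvd_refl p) K)) α P := fun _ => rfl
  change evalAt K α x ∈ _
  induction hx using Algebra.adjoin_induction with
  | mem x hx =>
    obtain ⟨j, hj, rfl⟩ := hx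
    rw [h, MvPolynomial.eval₂Hom_X']
    exact gen_mem_tower hj.1 hj.2
  | algebraMap r =>
    rw [h, MvPolynomial.algebraMap_eq, MvPolynomial.eval₂Hom_C]
    exact (tower K α i).algebraMap_mem _
  | add x y hx hy ihx ihy =>
    rw [h] at *
    rw [map_add]
    exact add_mem ihx ihy
  | mul x y hx hy ihx ihy =>
    rw [h] at *
    rw [map_mul]
    exact mul_mem ihx ihy

theorem map_evalAt (φ : E →ₐ[K] E) (α : ℕ → E) (P : MvPolynomial ℕ (ZMod p)) :
    φ (evalAt K α P) = evalAt K (fun j => φ (α j)) P := by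
  have h : ∀ α P, evalAt K α P =
    MvPolynomial.eval₂Hom ((algebraMap K E).comp (ZMod.castHom (dvd_refl p) K)) α P :=
    fun _ _ => rfl
  rw [h, h, ← RingHom.coe_coe φ, MvPolynomial.map_eval₂Hom]
  congr 2
  exact Subsingleton.elim _ _

theorem tower_le_equalizerField {α : ℕ → E} {φ ψ : E →ₐ[K] E} {i : ℕ}
    (h : ∀ j, 1 ≤ j → j ≤ i → φ (α j) = ψ (α j)) : tower K α i ≤ equalizerField φ ψ := by
  induction i with
  | zero => exact bot_le
  | succ i ih =>
    refine sup_le (ih fun j h1 h2 => h j h1 (by omega)) ?_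
    exact IntermediateField.adjoin_simple_le_iff.2 (h (i + 1) (by omega) le_rfl)

/-- The hypothesis on `α` says that `X_i` takes the value `a i ∈ K` at `α`, and `φ` fixes it; so `φ
∘ α` solves the same system. -/
theorem exists_genGal_of_algHom [CharP E p] (hD : IsGenericSystem F D) {α : ℕ → E} {a : ℕ → K}
    (hα : ∀ i, 1 ≤ i → i ≤ n → α i ^ p - α i = evalAt K α (D i) + algebraMap K E (a i))
    (φ : E →ₐ[K] E) :
    ∃ σ ∈ genGal D n, ∀ x : genS p n, φ (evalAt K α x.1) = evalAt K α (σ x).1 := by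
  obtain ⟨σ, hσ, h⟩ := hD.exists_genGal_of_solution (K := K) (α := α) (β := fun j => φ (α j))
    le_rfl fun j h1 h2 => by
      rw [← map_evalAt, evalAt_genX, hα j h1 h2, add_sub_cancel_left, AlgHom.commutes]
  exact ⟨σ, hσ, fun x => by rw [map_evalAt]; exact evalAt_eq_of_genVar h x⟩

/-- Every conjugate of `α i` is a polynomial in the `α j`, which gives normality; separability is
inherited from `E`. -/
theorem isGalois_tower [IsSepClosure K E] [CharP E p] (hD : IsGenericSystem F D) {α : ℕ → E}
    {a : ℕ → K}
    (hα : ∀ i, 1 ≤ i → i ≤ n → α i ^ p - α i = evalAt K α (D i) + algebraMap K E (a i)) :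
    IsGalois K (tower K α n) := by
  have : IsGalois K E := IsSepClosure.isGalois
  have : Normal K (tower K α n) := by
    rw [IntermediateField.normal_iff_forall_map_le]
    intro φ
    rw [IntermediateField.map_le_iff_le_comap]
    obtain ⟨σ, hσ, h⟩ := exists_genGal_of_algHom hD hα φ
    have key : ∀ i ≤ n, tower K α i ≤ (tower K α n).comap φ := by
      intro i hi
      induction i with
      | zero => exact bot_le
      | succ i ih =>
        refine sup_le (ih (by omega)) (IntermediateField.adjoin_simple_le_iff.2 ?_)
        have hj : i + 1 ∈ Set.Icc 1 n := ⟨by omega, hi⟩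
        have := h (genVar p n (i + 1) hj)
        rw [← evS_apply α n (genVar p n (i + 1) hj), evS_genVar] at this
        change φ (α (i + 1)) ∈ tower K α n
        rw [this]
        exact evalAt_mem_tower _
    exact key n le_rfl
  exact ⟨⟩

theorem exists_algHom_extending [IsSepClosure K E] {L : IntermediateField K E} (φ : L ≃ₐ[K] L) :
    ∃ ψ : E →ₐ[K] E, ∀ x : L, ψ x = φ x := by
  have : IsGalois K E := IsSepClosure.isGalois
  exact ⟨φ.liftNormal E, fun x => φ.liftNormal_commutes E x⟩

theorem exists_mulEquiv_gal [IsSepClosure K E] [CharP E p] (hD : IsGenericSystem F D)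
    {α : ℕ → E} {a : ℕ → K}
    (hα : ∀ i, 1 ≤ i → i ≤ n → α i ^ p - α i = evalAt K α (D i) + algebraMap K E (a i))
    (hrank : ∀ i ≤ n, Module.finrank K (tower K α i) = p ^ i) :
    ∃ μ : (tower K α n ≃ₐ[K] tower K α n) ≃* G,
      ∀ i, i ≤ n → (towerGal K α n i).map μ.toMonoidHom = F.sub i := by
  have hgal := isGalois_tower hD hα
  have : FiniteDimensional K (tower K α n) := by
    apply FiniteDimensional.of_finrank_pos
    rw [hrank n le_rfl]
    exact pow_pos hp.out.pos n
  obtain ⟨lam, hlam⟩ := hD.exists_lift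
  have hFn : F.sub n = ⊥ := by
    apply Subgroup.eq_bot_of_card_eq
    rw [F.card_sub, Nat.sub_self, pow_zero]
  let e : G ⧸ F.sub n ≃* G := (QuotientGroup.quotientMulEquivOfEq hFn).trans QuotientGroup.quotientBot
  have hcardG : Nat.card G = p ^ n := by
    have := F.card_sub 0
    rwa [F.sub_zero, Subgroup.card_top, Nat.sub_zero] at this
  have hcard : Nat.card (genGal D n) = p ^ n := by
    rw [Nat.card_congr ((lam n le_rfl).trans e).toEquiv, hcardG]
  have : Finite (genGal D n) := Nat.finite_of_card_ne_zero (by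
    rw [hcard]; exact (pow_pos hp.out.pos n).ne')
  let R : (tower K α n ≃ₐ[K] tower K α n) → genGal D n → Prop := fun φ σ =>
    ∀ x : genS p n, (φ ⟨evalAt K α x.1, evalAt_mem_tower x⟩ : E) = evalAt K α (σ.1 x).1
  have hex : ∀ φ, ∃ σ, R φ σ := by
    intro φ
    obtain ⟨ψ, hψ⟩ := exists_algHom_extending φ
    obtain ⟨σ, hσ, h⟩ := exists_genGal_of_algHom hD hα ψ
    refine ⟨⟨σ, hσ⟩, fun x => ?_⟩
    rw [← hψ]
    exact h x
  have huniq : ∀ φ φ' σ, R φ σ → R φ' σ → φ = φ' := by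
    intro φ φ' σ h h'
    obtain ⟨ψ, hψ⟩ := exists_algHom_extending φ
    obtain ⟨ψ', hψ'⟩ := exists_algHom_extending φ'
    have hle : tower K α n ≤ equalizerField ψ ψ' := by
      refine tower_le_equalizerField fun j h1 h2 => ?_
      have hj : j ∈ Set.Icc 1 n := ⟨h1, h2⟩
      have h3 := (h (genVar p n j hj)).trans (h' (genVar p n j hj)).symm
      rw [← hψ, ← hψ'] at h3
      simp only [← evS_apply α n (genVar p n j hj), evS_genVar] at h3
      exact h3
    refine AlgEquiv.ext fun x => Subtype.ext ?_
    rw [← hψ, ← hψ']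
    exact hle x.2
  have hmul : ∀ φ φ' σ σ', R φ σ → R φ' σ' → R (φ * φ') (σ * σ') := by
    intro φ φ' σ σ' h h' x
    rw [AlgEquiv.mul_apply]
    have : φ' ⟨evalAt K α x.1, evalAt_mem_tower x⟩ =
        ⟨evalAt K α (σ'.1 x).1, evalAt_mem_tower _⟩ := Subtype.ext (h' x)
    rw [this, h]
    rfl
  -- Evaluation at `α` is not known to be injective on `S_n`, so `f φ` is a choice. It is injective
  -- because `φ` is determined by its values on the `α j`, and bijective since both groups have
  -- order `p ^ n`; multiplicativity then follows from `huniq`.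
  choose f hf using hex
  have hinj : Function.Injective f := fun φ φ' h => huniq φ φ' (f φ) (hf φ) (h ▸ hf φ')
  have hbij : Function.Bijective f := by
    refine hinj.bijective_of_nat_card_le ?_
    rw [hcard, IsGalois.card_aut_eq_finrank, hrank n le_rfl]
  let fe : (tower K α n ≃ₐ[K] tower K α n) ≃* genGal D n :=
    { Equiv.ofBijective f hbij with
      map_mul' := fun φ φ' => by
        change f (φ * φ') = f φ * f φ'
        obtain ⟨χ, hχ⟩ := hbij.2 (f φ * f φ')
        have h1 := hmul φ φ' _ _ (hf φ) (hf φ')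
        rw [← hχ] at h1 ⊢
        rw [huniq _ _ _ h1 (hf χ)] }
  refine ⟨(fe.trans (lam n le_rfl)).trans e, fun i hi => ?_⟩
  have hGfin : Finite G := Nat.finite_of_card_ne_zero (by
    rw [hcardG]; exact (pow_pos hp.out.pos n).ne')
  symm
  -- One inclusion suffices, both sides having order `p ^ (n - i)`. An element of `G_(i)` restricts
  -- trivially to `S_i`, hence fixes `α 1, …, α i`.
  apply Subgroup.eq_of_le_of_card_ge
  · intro g hg
    obtain ⟨φ, hφ⟩ := ((fe.trans (lam n le_rfl)).trans e).surjective g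
    refine ⟨φ, ?_, hφ⟩
    have hφ' : lam n le_rfl (f φ) = QuotientGroup.mk g := by
      apply e.injective
      exact hφ
    obtain ⟨τ, hτ, hl⟩ := hlam i n hi le_rfl (f φ)
    have hτ1 : τ = 1 := by
      apply (lam i hi).injective
      rw [hl, hφ', map_one]
      exact (QuotientGroup.eq_one_iff _).2 hg
    rw [hτ1] at hτ
    obtain ⟨ψ, hψ⟩ := exists_algHom_extending φ
    have hle : tower K α i ≤ equalizerField ψ (AlgHom.id K E) := by
      refine tower_le_equalizerField fun j h1 h2 => ?_
      have hj : j ∈ Set.Icc 1 n := ⟨h1, by omega⟩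
      have h3 := hf φ (genVar p n j hj)
      have hj' : j ∈ Set.Icc 1 i := ⟨h1, h2⟩
      rw [← hτ (genVar p i j hj') (genVar p n j hj) rfl, ← hψ] at h3
      change ψ (evS K α n (genVar p n j hj)) = evS K α i (genVar p i j hj') at h3
      rw [evS_genVar, evS_genVar] at h3
      exact h3
    change φ ∈ IntermediateField.fixingSubgroup _
    rw [IntermediateField.mem_fixingSubgroup_iff]
    intro x hx
    apply Subtype.ext
    rw [← hψ]
    exact hle hx
  · rw [Subgroup.card_map_of_injective ((fe.trans (lam n le_rfl)).trans e).injective, F.card_sub]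
    have h1 : (tower K α i).comap (tower K α n).val =
        IntermediateField.restrict (tower_mono hi) := by
      ext x
      rw [IntermediateField.mem_restrict]
      rfl
    have h2 : Module.finrank K (IntermediateField.restrict (tower_mono (K := K) (α := α) hi)) =
        p ^ i := by
      rw [← hrank i hi]
      exact (IntermediateField.restrictAlgEquiv (tower_mono hi)).toLinearEquiv.finrank_eq.symm
    have h3 : Nat.card (towerGal K α n i) = Module.finrank
        (IntermediateField.restrict (tower_mono (K := K) (α := α) hi)) (tower K α n) := by
      rw [towerGal, h1, IsGalois.card_fixingSubgroup_eq_finrank]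
    have h4 := Module.finrank_mul_finrank K
      (IntermediateField.restrict (tower_mono (K := K) (α := α) hi)) (tower K α n)
    rw [h2, hrank n le_rfl, ← h3] at h4
    have h5 : p ^ i * p ^ (n - i) = p ^ n := by rw [← pow_add, Nat.add_sub_cancel' hi]
    exact (Nat.eq_of_mul_eq_mul_left (pow_pos hp.out.pos i) (h4.trans h5.symm)).le

end GaloisGroup

/-! ### Ramification numbers and lower ramification groups. -/

section RamificationNumbers

open WithZero

variable {K : Type*} [Field K] {E : Type*} [Field E] [Algebra K E]
  {v : Valuation E ℝᵐ⁰} {L : IntermediateField K E} {N p : ℕ}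

theorem TotRam.exists_eq_exp_div (hL : TotRam v L N) {x : E} (hx : x ≠ 0) :
    ∃ r : ℝ, v x = exp (r / N) := by
  have hN : (N : ℝ) ≠ 0 := by exact_mod_cast hL.pos.ne'
  refine ⟨N * log (v x), ?_⟩
  rw [mul_div_cancel_left₀ _ hN, exp_log ((Valuation.ne_zero_iff v).2 hx)]

theorem mem_towerGal_iff {α : ℕ → E} {n i : ℕ} {σ : tower K α n ≃ₐ[K] tower K α n} :
    σ ∈ towerGal K α n i ↔ ∀ x : tower K α n, (x : E) ∈ tower K α i → σ x = x :=
  IntermediateField.mem_fixingSubgroup_iff _ _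

theorem towerGal_anti (α : ℕ → E) (n : ℕ) : Antitone (towerGal K α n) := fun _ _ hij _ hσ =>
  mem_towerGal_iff.2 fun x hx => mem_towerGal_iff.1 hσ x (tower_mono hij hx)

theorem towerGal_zero (α : ℕ → E) (n : ℕ) : towerGal K α n 0 = ⊤ := by
  refine eq_top_iff.2 fun σ _ => mem_towerGal_iff.2 fun x hx => ?_
  obtain ⟨c, hc⟩ := IntermediateField.mem_bot.1 hx
  have : x = algebraMap K (tower K α n) c := Subtype.ext hc.symm
  rw [this, AlgEquiv.commutes]

theorem towerGal_self (α : ℕ → E) (n : ℕ) : towerGal K α n n = ⊥ :=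
  eq_bot_iff.2 fun _ hσ => Subgroup.mem_bot.2 (AlgEquiv.ext fun x => mem_towerGal_iff.1 hσ x x.2)

/-- The jump of `σ ∉ Gal(K_n / K_i)` in the filtration by the groups `Gal(K_n / K_j)`. -/
theorem exists_jump {α : ℕ → E} {n i : ℕ} {σ : tower K α n ≃ₐ[K] tower K α n}
    (hσ : σ ∉ towerGal K α n i) :
    ∃ j < i, σ ∈ towerGal K α n j ∧ σ ∉ towerGal K α n (j + 1) := by
  induction i with
  | zero => exact absurd (by rw [towerGal_zero]; trivial) hσ
  | succ i ih =>
    by_cases h : σ ∈ towerGal K α n i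
    · exact ⟨i, Nat.lt_succ_self i, h, hσ⟩
    · obtain ⟨j, hj, h1⟩ := ih h
      exact ⟨j, by omega, h1⟩

variable [Valued K ℤᵐ⁰]

/-- An element of order `1 / N` forces `N` to divide every admissible `e`. -/
theorem TotRam.ramIndex_eq (hL : TotRam v L N)
    (hv : ∀ x : E, x ≠ 0 → extVal K x = ((-(log (v x)) : ℝ) : EReal)) : ramIndex K L = N := by
  have hN : (N : ℝ) ≠ 0 := by exact_mod_cast hL.pos.ne'
  have hmem : N ∈ {e : ℕ | 0 < e ∧ ∀ x ∈ L, x ≠ 0 →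
      ∃ m : ℤ, (e : EReal) * extVal K x = ((m : ℝ) : EReal)} := by
    refine ⟨hL.pos, fun x hx hx0 => ?_⟩
    obtain ⟨m, hm⟩ := hL.val x hx hx0
    refine ⟨-m, ?_⟩
    rw [hv x hx0, hm, log_exp, ← EReal.coe_natCast, ← EReal.coe_mul, EReal.coe_eq_coe_iff]
    push_cast
    field_simp
  refine le_antisymm (Nat.sInf_le hmem) (le_csInf ⟨N, hmem⟩ ?_)
  rintro e ⟨he, h⟩
  obtain ⟨x, hx, hxv⟩ := hL.exists_val 1
  have hx0 : x ≠ 0 := (Valuation.ne_zero_iff v).1 (by rw [hxv]; exact exp_ne_zero)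
  obtain ⟨m, hm⟩ := h x hx hx0
  rw [hv x hx0, hxv, log_exp, ← EReal.coe_natCast, ← EReal.coe_mul, EReal.coe_eq_coe_iff] at hm
  push_cast at hm
  field_simp at hm
  have h1 : (e : ℤ) = N * (-m) := by
    have : (e : ℝ) = N * (-m) := by linarith
    exact_mod_cast this
  exact Nat.le_of_dvd he (Int.natCast_dvd_natCast.1 ⟨-m, h1⟩)

theorem TotRam.normVal_eq (hL : TotRam v L N)
    (hv : ∀ x : E, x ≠ 0 → extVal K x = ((-(log (v x)) : ℝ) : EReal)) {x : E} {r : ℝ}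
    (hx : v x = exp (r / N)) : normVal K L x = ((-r : ℝ) : EReal) := by
  have hN : (N : ℝ) ≠ 0 := by exact_mod_cast hL.pos.ne'
  have hx0 : x ≠ 0 := (Valuation.ne_zero_iff v).1 (by rw [hx]; exact exp_ne_zero)
  rw [normVal, hL.ramIndex_eq hv, hv x hx0, hx, log_exp, ← EReal.coe_natCast, ← EReal.coe_mul,
    EReal.coe_eq_coe_iff]
  field_simp

theorem TotRam.normVal_zero (hL : TotRam v L N)
    (hv : ∀ x : E, x ≠ 0 → extVal K x = ((-(log (v x)) : ℝ) : EReal)) :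
    normVal K L (0 : E) = ⊤ := by
  rw [normVal, hL.ramIndex_eq hv, extVal, if_pos rfl, ← EReal.coe_natCast]
  exact EReal.coe_mul_top_of_pos (by exact_mod_cast hL.pos)

theorem TotRam.normVal_pos_iff (hL : TotRam v L N)
    (hv : ∀ x : E, x ≠ 0 → extVal K x = ((-(log (v x)) : ℝ) : EReal)) (x : E) :
    0 < normVal K L x ↔ v x < 1 := by
  have hN : (0 : ℝ) < N := by exact_mod_cast hL.pos
  by_cases hx : x = 0
  · rw [hx, hL.normVal_zero hv, map_zero]
    simp
  obtain ⟨r, hr⟩ := hL.exists_eq_exp_div hx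
  rw [hL.normVal_eq hv hr, hr, ← exp_zero, exp_lt_exp, EReal.coe_pos, neg_pos,
    div_lt_iff₀ hN, zero_mul]

theorem TotRam.normVal_nonneg_iff (hL : TotRam v L N)
    (hv : ∀ x : E, x ≠ 0 → extVal K x = ((-(log (v x)) : ℝ) : EReal)) (x : E) :
    0 ≤ normVal K L x ↔ v x ≤ 1 := by
  have hN : (0 : ℝ) < N := by exact_mod_cast hL.pos
  by_cases hx : x = 0
  · rw [hx, hL.normVal_zero hv, map_zero]
    simp
  obtain ⟨r, hr⟩ := hL.exists_eq_exp_div hx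
  rw [hL.normVal_eq hv hr, hr, ← exp_zero, exp_le_exp, EReal.coe_nonneg, neg_nonneg,
    div_le_iff₀ hN, zero_mul]

theorem TotRam.valuation_uniformizer (hL : TotRam v L N)
    (hv : ∀ x : E, x ≠ 0 → extVal K x = ((-(log (v x)) : ℝ) : EReal)) :
    v (uniformizer L : E) = exp ((-1 : ℝ) / N) := by
  have hspec : normVal K L ((uniformizer L : L) : E) = 1 := by
    refine Classical.epsilon_spec (p := fun x : L => normVal K L (x : E) = 1) ?_
    obtain ⟨x, hx, hxv⟩ := hL.exists_val (-1)
    refine ⟨⟨x, hx⟩, ?_⟩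
    rw [hL.normVal_eq hv hxv]
    simp
  by_cases h0 : ((uniformizer L : L) : E) = 0
  · rw [h0, hL.normVal_zero hv] at hspec
    exact absurd hspec.symm (EReal.coe_ne_top 1)
  obtain ⟨r, hr⟩ := hL.exists_eq_exp_div h0
  rw [hL.normVal_eq hv hr, ← EReal.coe_one, EReal.coe_eq_coe_iff] at hspec
  rw [hr, ← hspec, neg_neg]

theorem TotRam.ramNumber_one (hL : TotRam v L N)
    (hv : ∀ x : E, x ≠ 0 → extVal K x = ((-(log (v x)) : ℝ) : EReal)) :
    ramNumber L 1 = ⊤ := by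
  have h : InInertia L 1 := by
    intro x _
    rw [AlgEquiv.one_apply, sub_self, ZeroMemClass.coe_zero, hL.normVal_zero hv]
    exact EReal.zero_lt_top
  rw [ramNumber, if_pos h, AlgEquiv.one_apply, sub_self, ZeroMemClass.coe_zero, hL.normVal_zero hv,
    ← EReal.coe_one, EReal.top_sub_coe]

theorem TotRam.ramNumber_eq (hL : TotRam v L N)
    (hv : ∀ x : E, x ≠ 0 → extVal K x = ((-(log (v x)) : ℝ) : EReal)) (hp : p.Prime)
    {σ : L ≃ₐ[K] L} {ψ : E →ₐ[K] E} (hψ : ∀ x : L, ψ x = σ x) {c : ℤ} (hc : 0 < c)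
    (hσ : HasRamBreak v L N p ψ c) : ramNumber L σ = ((c : ℝ) : EReal) := by
  have hN : (0 : ℝ) < N := by exact_mod_cast hL.pos
  have hcr : (0 : ℝ) < c := by exact_mod_cast hc
  have h : InInertia L σ := by
    intro x hx
    rw [hL.normVal_nonneg_iff hv] at hx
    rw [hL.normVal_pos_iff hv]
    by_cases h0 : (x : E) = 0
    · have : x = 0 := Subtype.ext h0
      rw [this]
      simp
    obtain ⟨m, hm⟩ := hL.val x x.2 h0
    have hle : v (ψ x - x) ≤ exp (((m - c : ℤ) : ℝ) / N) := by
      by_cases h : (p : ℤ) ∣ m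
      · exact ((hσ x x.2 m hm).2 h).le
      · exact ((hσ x x.2 m hm).1 h).le
    rw [hψ] at hle
    refine hle.trans_lt (lt_of_lt_of_le ?_ hx)
    rw [hm, exp_lt_exp]
    push_cast
    gcongr
    linarith
  have hπ := hL.valuation_uniformizer hv
  -- The uniformizer has pole order `-1`, prime to `p`, so `HasRamBreak` gives an equality there.
  have hp1 : ¬ (p : ℤ) ∣ -1 := by
    rw [dvd_neg]
    intro h
    exact hp.one_lt.ne' (by exact_mod_cast Int.eq_one_of_dvd_one (by positivity) h)
  have h1 := (hσ (uniformizer L : L) (uniformizer L).2 (-1) (by rw [hπ]; push_cast; rfl)).1 hp1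
  rw [hψ, ← AddSubgroupClass.coe_sub] at h1
  rw [ramNumber, if_pos h, hL.normVal_eq hv h1, ← EReal.coe_one, ← EReal.coe_sub,
    EReal.coe_eq_coe_iff]
  push_cast
  ring

variable [hp : Fact p.Prime] [CharP E p] {n : ℕ} {u : ℕ → ℕ} {b : ℕ → ℤ} {α : ℕ → E}

theorem ramNumber_tower [IsSepClosure K E] (h : BreakData p n u b)
    (hv : ∀ x : E, x ≠ 0 → extVal K x = ((-(log (v x)) : ℝ) : EReal))
    (hram : ∀ j ≤ n, TotRam v (tower K α j) (p ^ j))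
    (hgen : ∀ j < n, HasReducedGenerator K v α b p j) {i : ℕ} (hi : i < n)
    {σ : tower K α n ≃ₐ[K] tower K α n}
    (hσ : σ ∈ towerGal K α n i) (hσ' : σ ∉ towerGal K α n (i + 1)) :
    ramNumber (tower K α n) σ = ((b (i + 1) : ℝ) : EReal) := by
  have : IsGalois K E := IsSepClosure.isGalois
  obtain ⟨ψ, hψ⟩ := exists_algHom_extending σ
  rw [mem_towerGal_iff] at hσ hσ'
  push Not at hσ'
  obtain ⟨x, hx, hσx⟩ := hσ'
  refine (hram n le_rfl).ramNumber_eq hv hp.out hψ (h.b_pos (by omega) (by omega)) ?_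
  refine hasRamBreak_tower h hram hgen ψ (valuation_algHom hv ψ) ?_ ⟨x, hx, ?_⟩ hi le_rfl
  · intro y hy
    have := hψ ⟨y, tower_mono (by omega) hy⟩
    rw [hσ _ hy] at this
    exact this
  · rw [hψ]
    exact fun h => hσx (Subtype.ext h)

/-- Since the `b j` increase, the ramification number `b (j + 1)` of `σ` is at least `t` exactly
when its jump `j` is at least `i`. -/
theorem lowerRam_tower [IsSepClosure K E] (h : BreakData p n u b)
    (hv : ∀ x : E, x ≠ 0 → extVal K x = ((-(log (v x)) : ℝ) : EReal))
    (hram : ∀ j ≤ n, TotRam v (tower K α j) (p ^ j))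
    (hgen : ∀ j < n, HasReducedGenerator K v α b p j) {i : ℕ} (hi : i ≤ n) {t : ℝ}
    (hit : 1 ≤ i → (b i : ℝ) < t) (hti : i < n → t ≤ b (i + 1)) :
    lowerRam (tower K α n) t = (towerGal K α n i : Set (tower K α n ≃ₐ[K] tower K α n)) := by
  ext σ
  change (t : EReal) ≤ ramNumber _ σ ↔ σ ∈ towerGal K α n i
  constructor
  · intro hσ
    by_contra hσi
    obtain ⟨j, hj, h1, h2⟩ := exists_jump hσi
    rw [ramNumber_tower h hv hram hgen (by omega) h1 h2, EReal.coe_le_coe_iff] at hσ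
    have h3 : b (j + 1) ≤ b i := by
      rcases Nat.eq_or_lt_of_le (show j + 1 ≤ i by omega) with rfl | hlt
      · exact le_rfl
      · exact (h.b_lt_of_lt (by omega) hlt hi).le
    have h4 : (b (j + 1) : ℝ) ≤ b i := by exact_mod_cast h3
    linarith [hit (by omega)]
  · intro hσ
    by_cases h1 : σ = 1
    · rw [h1, (hram n le_rfl).ramNumber_one hv]
      exact le_top
    have hσn : σ ∉ towerGal K α n n := by
      rw [towerGal_self]
      exact fun h => h1 (Subgroup.mem_bot.1 h)
    obtain ⟨j, hj, h2, h3⟩ := exists_jump hσn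
    have hij : i ≤ j := by
      by_contra! hlt
      exact h3 (towerGal_anti α n (by omega) hσ)
    rw [ramNumber_tower h hv hram hgen hj h2 h3, EReal.coe_le_coe_iff]
    have h4 : b (i + 1) ≤ b (j + 1) := by
      rcases Nat.eq_or_lt_of_le hij with rfl | hlt
      · exact le_rfl
      · exact (h.b_lt_of_lt (by omega) (by omega) (by omega)).le
    have h5 : (b (i + 1) : ℝ) ≤ b (j + 1) := by exact_mod_cast h4
    linarith [hti (by omega)]

end RamificationNumbers

/-! ### The Hasse-Herbrand function and the upper numbering. -/

section Herbrand

variable {K : Type*} [Field K] [Valued K ℤᵐ⁰] {E : Type*} [Field E] [Algebra K E]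
  {L : IntermediateField K E} {p n : ℕ} {u : ℕ → ℕ} {b : ℕ → ℤ}

/-- `t` lies in the `i`-th of the intervals into which the `b_j` divide the real line. -/
def InBreakInterval (n : ℕ) (b : ℕ → ℤ) (i : ℕ) (t : ℝ) : Prop :=
  (1 ≤ i → (b i : ℝ) < t) ∧ (i < n → t ≤ b (i + 1))

theorem exists_inBreakInterval (n : ℕ) (b : ℕ → ℤ) (t : ℝ) :
    ∃ i ≤ n, InBreakInterval n b i t := by
  have h : ∀ m ≤ n, (∃ i < m, InBreakInterval n b i t) ∨ (1 ≤ m → (b m : ℝ) < t) := by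
    intro m hm
    induction m with
    | zero => exact Or.inr fun h => absurd h (by omega)
    | succ m ih =>
      rcases ih (by omega) with ⟨i, hi, h⟩ | h
      · exact Or.inl ⟨i, by omega, h⟩
      · by_cases ht : t ≤ b (m + 1)
        · exact Or.inl ⟨m, by omega, h, fun _ => ht⟩
        · exact Or.inr fun _ => not_le.1 ht
  rcases h n le_rfl with ⟨i, hi, h⟩ | h
  · exact ⟨i, hi.le, h⟩
  · exact ⟨n, le_rfl, h, fun h => absurd h (lt_irrefl n)⟩

theorem inBreakInterval_break {i : ℕ} [Fact p.Prime] (h : BreakData p n u b) (hi : i < n) :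
    InBreakInterval n b i (b (i + 1)) :=
  ⟨fun h1 => by exact_mod_cast h.b_lt h1 hi, fun _ => le_rfl⟩

theorem le_of_break_lt {i k : ℕ} [Fact p.Prime] (h : BreakData p n u b) {t : ℝ} (hi : 1 ≤ i)
    (hin : i ≤ n) (ht : (b i : ℝ) < t) (hk : InBreakInterval n b k t) : i ≤ k := by
  by_contra! hlt
  have h1 := hk.2 (by omega)
  have h2 : b (k + 1) ≤ b i := by
    rcases Nat.eq_or_lt_of_le (show k + 1 ≤ i by omega) with rfl | hlt
    · exact le_rfl
    · exact (h.b_lt_of_lt (by omega) hlt hin).le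
  have h3 : (b (k + 1) : ℝ) ≤ b i := by exact_mod_cast h2
  linarith

theorem lowerRam_anti (L : IntermediateField K E) : Antitone (lowerRam L) :=
  fun _ _ hst _ hσ => (EReal.coe_le_coe_iff.2 hst).trans hσ

/-- The lower ramification groups of `L` are the groups `H_i`, of order `p ^ (n - i)`,
with breaks at the `b_i`. -/
structure IsLowerFiltration (p n : ℕ) (b : ℕ → ℤ) (L : IntermediateField K E)
    (H : ℕ → Set (L ≃ₐ[K] L)) : Prop where
  finite : Finite (L ≃ₐ[K] L)
  lowerRam_eq : ∀ i ≤ n, ∀ t, InBreakInterval n b i t → lowerRam L t = H i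
  ncard : ∀ i ≤ n, (H i).ncard = p ^ (n - i)

variable {H : ℕ → Set (L ≃ₐ[K] L)}

/-- The derivative of the Hasse-Herbrand function. -/
def ramDensity (L : IntermediateField K E) (t : ℝ) : ℝ :=
  ((lowerRam L t).ncard : ℝ) / ((lowerRam L 0).ncard : ℝ)

theorem IsLowerFiltration.intervalIntegrable (hH : IsLowerFiltration p n b L H) (x y : ℝ) :
    IntervalIntegrable (ramDensity L) MeasureTheory.volume x y := by
  have := hH.finite
  apply Antitone.intervalIntegrable
  intro s t hst
  refine div_le_div_of_nonneg_right ?_ (Nat.cast_nonneg _)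
  exact_mod_cast Set.ncard_le_ncard (lowerRam_anti L hst) (Set.toFinite _)

theorem IsLowerFiltration.herbrand_sub (hH : IsLowerFiltration p n b L H) (x y : ℝ) :
    herbrand L y - herbrand L x = ∫ t in x..y, ramDensity L t :=
  intervalIntegral.integral_interval_sub_left (hH.intervalIntegrable _ _)
    (hH.intervalIntegrable _ _)

theorem herbrand_zero (L : IntermediateField K E) : herbrand L 0 = 0 :=
  intervalIntegral.integral_same

variable [hp : Fact p.Prime]

theorem IsLowerFiltration.ramDensity_eq (hH : IsLowerFiltration p n b L H)
    (h : BreakData p n u b) {i : ℕ} (hi : i ≤ n) {t : ℝ} (ht : InBreakInterval n b i t) :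
    ramDensity L t = ((p : ℝ) ^ i)⁻¹ := by
  have h0 : InBreakInterval n b 0 0 := by
    refine ⟨fun h => absurd h (by omega), fun hn => ?_⟩
    exact_mod_cast (h.b_pos (i := 1) le_rfl (by omega)).le
  have hp0 : (p : ℝ) ≠ 0 := by exact_mod_cast hp.out.ne_zero
  rw [ramDensity, hH.lowerRam_eq i hi t ht, hH.lowerRam_eq 0 (Nat.zero_le n) 0 h0, hH.ncard i hi,
    hH.ncard 0 (Nat.zero_le n), Nat.sub_zero]
  push_cast
  rw [eq_comm, inv_eq_one_div, div_eq_div_iff (pow_ne_zero _ hp0) (pow_ne_zero _ hp0), one_mul,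
    ← pow_add, Nat.sub_add_cancel hi]

/-- A positive lower bound on the slope makes `herbrand` strictly increasing and unbounded. -/
theorem IsLowerFiltration.le_ramDensity (hH : IsLowerFiltration p n b L H)
    (h : BreakData p n u b) (t : ℝ) : ((p : ℝ) ^ n)⁻¹ ≤ ramDensity L t := by
  obtain ⟨i, hi, ht⟩ := exists_inBreakInterval n b t
  rw [hH.ramDensity_eq h hi ht]
  have hp0 : (0 : ℝ) < p := by exact_mod_cast hp.out.pos
  have hp1 : (1 : ℝ) ≤ p := by exact_mod_cast hp.out.one_le
  exact inv_anti₀ (pow_pos hp0 _) (pow_le_pow_right₀ hp1 hi)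

theorem IsLowerFiltration.le_herbrand_sub (hH : IsLowerFiltration p n b L H)
    (h : BreakData p n u b) {x y : ℝ} (hxy : x ≤ y) :
    (y - x) * ((p : ℝ) ^ n)⁻¹ ≤ herbrand L y - herbrand L x := by
  rw [hH.herbrand_sub, ← smul_eq_mul, ← intervalIntegral.integral_const]
  exact intervalIntegral.integral_mono_on hxy intervalIntegrable_const
    (hH.intervalIntegrable _ _) fun t _ => hH.le_ramDensity h t

theorem IsLowerFiltration.herbrand_sub_eq (hH : IsLowerFiltration p n b L H)
    (h : BreakData p n u b) {i : ℕ} (hi : i ≤ n) {x y : ℝ} (hxy : x ≤ y)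
    (hI : ∀ t, x < t → t ≤ y → InBreakInterval n b i t) :
    herbrand L y - herbrand L x = (y - x) * ((p : ℝ) ^ i)⁻¹ := by
  rw [hH.herbrand_sub, ← smul_eq_mul, ← intervalIntegral.integral_const,
    intervalIntegral.integral_of_le hxy, intervalIntegral.integral_of_le hxy]
  exact MeasureTheory.setIntegral_congr_fun measurableSet_Ioc
    fun t ht => hH.ramDensity_eq h hi (hI t ht.1 ht.2)

theorem IsLowerFiltration.herbrand_strictMono (hH : IsLowerFiltration p n b L H)
    (h : BreakData p n u b) : StrictMono (herbrand L) := by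
  intro x y hxy
  have h1 := hH.le_herbrand_sub h hxy.le
  have hp0 : (0 : ℝ) < p := by exact_mod_cast hp.out.pos
  have : 0 < (y - x) * ((p : ℝ) ^ n)⁻¹ := mul_pos (sub_pos.2 hxy) (by positivity)
  linarith

theorem IsLowerFiltration.herbrand_neg_one (hH : IsLowerFiltration p n b L H)
    (h : BreakData p n u b) : herbrand L (-1) = -1 := by
  have h1 := hH.herbrand_sub_eq h (Nat.zero_le n) (x := -1) (y := 0) (by norm_num) (by
    intro t _ ht
    refine ⟨fun h => absurd h (by omega), fun hn => ht.trans ?_⟩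
    exact_mod_cast (h.b_pos (i := 1) le_rfl (by omega)).le)
  rw [herbrand_zero] at h1
  norm_num at h1
  linarith

/-- On the interval from `b i` to `b (i + 1)` the slope is `p ^ (-i)`, which cancels the factor `p ^
i` in the recursion for `b`. -/
theorem IsLowerFiltration.herbrand_break (hH : IsLowerFiltration p n b L H)
    (h : BreakData p n u b) {i : ℕ} (hi : i < n) : herbrand L (b (i + 1)) = u (i + 1) := by
  have hp0 : (p : ℝ) ≠ 0 := by exact_mod_cast hp.out.ne_zero
  induction i with
  | zero =>
    have hb : (0 : ℝ) ≤ b (0 + 1) := by exact_mod_cast (h.b_pos (i := 1) le_rfl (by omega)).le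
    have h1 := hH.herbrand_sub_eq h (Nat.zero_le n) hb fun t _ ht =>
      ⟨fun h => absurd h (by omega), fun _ => ht⟩
    rw [herbrand_zero, zero_add, h.b_one] at h1
    rw [zero_add, h.b_one]
    simpa using h1
  | succ i ih =>
    have hb : (b (i + 1) : ℝ) ≤ b (i + 1 + 1) := by
      exact_mod_cast (h.b_lt (i := i + 1) (by omega) hi).le
    have h1 := hH.herbrand_sub_eq h hi.le hb fun t ht1 ht2 => ⟨fun _ => ht1, fun _ => ht2⟩
    rw [ih (by omega)] at h1
    have h2 : (b (i + 1 + 1) : ℝ) - b (i + 1) =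
        (p : ℝ) ^ (i + 1) * ((u (i + 1 + 1) : ℝ) - u (i + 1)) := by
      exact_mod_cast h.b_succ (i + 1) (by omega) hi
    rw [h2] at h1
    field_simp at h1
    linarith

theorem IsLowerFiltration.exists_herbrand_eq (hH : IsLowerFiltration p n b L H)
    (h : BreakData p n u b) {y : ℝ} (hy : -1 ≤ y) :
    ∃ x ∈ Set.Ici (-1 : ℝ), herbrand L x = y := by
  have hp0 : (0 : ℝ) < p := by exact_mod_cast hp.out.pos
  have hP : (0 : ℝ) < (p : ℝ) ^ n := pow_pos hp0 n
  have hcont : Continuous (herbrand L) :=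
    intervalIntegral.continuous_primitive hH.intervalIntegrable 0
  -- A line of slope `p ^ (-n)` through `(-1, -1)` reaches height `y` at `z`, and `herbrand` lies
  -- above it.
  set z : ℝ := -1 + (y + 1) * (p : ℝ) ^ n with hz
  have hz1 : -1 ≤ z := by
    have : 0 ≤ (y + 1) * (p : ℝ) ^ n := mul_nonneg (by linarith) hP.le
    linarith
  have h1 := hH.le_herbrand_sub h hz1
  rw [hH.herbrand_neg_one h, hz, add_comm (-1 : ℝ), sub_neg_eq_add, neg_add_cancel_right,
    mul_inv_cancel_right₀ hP.ne'] at h1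
  obtain ⟨x, hx, hxy⟩ := intermediate_value_Icc hz1 hcont.continuousOn
    (show y ∈ Set.Icc (herbrand L (-1)) (herbrand L z) by
      rw [hH.herbrand_neg_one h]
      refine ⟨hy, ?_⟩
      rw [hz, add_comm (-1 : ℝ)]
      linarith)
  exact ⟨x, hx.1, hxy⟩

theorem IsLowerFiltration.herbrandInv_mem (hH : IsLowerFiltration p n b L H)
    (h : BreakData p n u b) {y : ℝ} (hy : -1 ≤ y) : -1 ≤ herbrandInv L y :=
  Function.invFunOn_mem (hH.exists_herbrand_eq h hy)

theorem IsLowerFiltration.herbrand_herbrandInv (hH : IsLowerFiltration p n b L H)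
    (h : BreakData p n u b) {y : ℝ} (hy : -1 ≤ y) : herbrand L (herbrandInv L y) = y :=
  Function.invFunOn_eq (hH.exists_herbrand_eq h hy)

theorem IsLowerFiltration.neg_one_le_herbrand (hH : IsLowerFiltration p n b L H)
    (h : BreakData p n u b) {x : ℝ} (hx : -1 ≤ x) : -1 ≤ herbrand L x := by
  rw [← hH.herbrand_neg_one h]
  exact (hH.herbrand_strictMono h).monotone hx

theorem IsLowerFiltration.herbrandInv_herbrand (hH : IsLowerFiltration p n b L H)
    (h : BreakData p n u b) {x : ℝ} (hx : -1 ≤ x) : herbrandInv L (herbrand L x) = x :=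
  (hH.herbrand_strictMono h).injective
    (hH.herbrand_herbrandInv h (hH.neg_one_le_herbrand h hx))

theorem IsLowerFiltration.upperBreaks_eq_image (hH : IsLowerFiltration p n b L H)
    (h : BreakData p n u b) : upperBreaks L = herbrand L '' lowerBreaks L := by
  have hmono := hH.herbrand_strictMono h
  ext y
  constructor
  · rintro ⟨hy, hne⟩
    refine ⟨herbrandInv L y, ⟨hH.herbrandInv_mem h hy, fun ε hε => ?_⟩,
      hH.herbrand_herbrandInv h hy⟩
    have h1 := hmono (lt_add_of_pos_right (herbrandInv L y) hε)
    rw [hH.herbrand_herbrandInv h hy] at h1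
    have h2 := hne _ (sub_pos.2 h1)
    rw [upperRam, upperRam, add_sub_cancel, hH.herbrandInv_herbrand h] at h2
    · exact h2
    · linarith [hH.herbrandInv_mem h hy]
  · rintro ⟨x, ⟨hx, hne⟩, rfl⟩
    have hy := hH.neg_one_le_herbrand h hx
    refine ⟨hy, fun ε hε => ?_⟩
    have hyε : -1 ≤ herbrand L x + ε := by linarith
    have h1 : x < herbrandInv L (herbrand L x + ε) := by
      rw [← hmono.lt_iff_lt, hH.herbrand_herbrandInv h hyε]
      linarith
    have h2 := hne _ (sub_pos.2 h1)
    rw [add_sub_cancel] at h2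
    rw [upperRam, upperRam, hH.herbrandInv_herbrand h hx]
    exact h2

theorem IsLowerFiltration.lowerBreaks_eq (hH : IsLowerFiltration p n b L H)
    (h : BreakData p n u b) : lowerBreaks L = {x : ℝ | ∃ i, 1 ≤ i ∧ i ≤ n ∧ x = b i} := by
  ext t
  constructor
  · rintro ⟨-, hne⟩
    obtain ⟨i, hi, ht⟩ := exists_inBreakInterval n b t
    have hti := hH.lowerRam_eq i hi t ht
    rcases Nat.eq_or_lt_of_le hi with rfl | hlt
    · refine absurd ?_ (hne 1 one_pos)
      rw [hti, hH.lowerRam_eq i hi]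
      exact ⟨fun h1 => by linarith [ht.1 h1], fun h1 => absurd h1 (lt_irrefl i)⟩
    · rcases (ht.2 hlt).lt_or_eq with h1 | h1
      · refine absurd ?_ (hne _ (sub_pos.2 h1))
        rw [hti, add_sub_cancel, hH.lowerRam_eq i hi _ (inBreakInterval_break h hlt)]
      · exact ⟨i + 1, by omega, hlt, h1⟩
  · rintro ⟨i, hi1, hi, rfl⟩
    obtain ⟨j, rfl⟩ : ∃ j, i = j + 1 := ⟨i - 1, by omega⟩
    refine ⟨?_, fun ε hε heq => ?_⟩
    · have : (0 : ℝ) < b (j + 1) := by exact_mod_cast h.b_pos hi1 hi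
      linarith
    · obtain ⟨k, hk, hkt⟩ := exists_inBreakInterval n b (b (j + 1) + ε)
      rw [hH.lowerRam_eq j (by omega) _ (inBreakInterval_break h hi),
        hH.lowerRam_eq k hk _ hkt] at heq
      have hjk := le_of_break_lt h hi1 hi (lt_add_of_pos_right _ hε) hkt
      have h1 := hH.ncard j (by omega)
      rw [heq, hH.ncard k hk] at h1
      have := Nat.pow_right_injective hp.out.two_le h1
      omega

theorem IsLowerFiltration.upperBreaks_eq (hH : IsLowerFiltration p n b L H)
    (h : BreakData p n u b) : upperBreaks L = {x : ℝ | ∃ i, 1 ≤ i ∧ i ≤ n ∧ x = u i} := by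
  rw [hH.upperBreaks_eq_image h, hH.lowerBreaks_eq h]
  have key : ∀ i, 1 ≤ i → i ≤ n → herbrand L (b i) = u i := by
    intro i h1 h2
    obtain ⟨j, rfl⟩ : ∃ j, i = j + 1 := ⟨i - 1, by omega⟩
    exact hH.herbrand_break h h2
  ext y
  constructor
  · rintro ⟨_, ⟨i, h1, h2, rfl⟩, rfl⟩
    exact ⟨i, h1, h2, key i h1 h2⟩
  · rintro ⟨i, h1, h2, rfl⟩
    exact ⟨b i, ⟨i, h1, h2, rfl⟩, key i h1 h2⟩

theorem IsLowerFiltration.lowerRam_range (hH : IsLowerFiltration p n b L H)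
    (h : BreakData p n u b) :
    {S | ∃ t : ℝ, -1 ≤ t ∧ S = lowerRam L t} = {S | ∃ i, i ≤ n ∧ S = H i} := by
  ext S
  constructor
  · rintro ⟨t, -, rfl⟩
    obtain ⟨i, hi, ht⟩ := exists_inBreakInterval n b t
    exact ⟨i, hi, hH.lowerRam_eq i hi t ht⟩
  · rintro ⟨i, hi, rfl⟩
    rcases Nat.eq_or_lt_of_le hi with rfl | hlt
    · refine ⟨max (0 : ℝ) (b i) + 1, ?_, (hH.lowerRam_eq i hi _ ⟨fun _ => ?_, fun h1 => ?_⟩).symm⟩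
      · linarith [le_max_left (0 : ℝ) (b i)]
      · linarith [le_max_right (0 : ℝ) (b i)]
      · exact absurd h1 (lt_irrefl i)
    · refine ⟨b (i + 1), ?_, (hH.lowerRam_eq i hi _ (inBreakInterval_break h hlt)).symm⟩
      have : (0 : ℝ) < b (i + 1) := by exact_mod_cast h.b_pos (i := i + 1) (by omega) hlt
      linarith

theorem IsLowerFiltration.upperRam_range (hH : IsLowerFiltration p n b L H)
    (h : BreakData p n u b) :
    {S | ∃ x : ℝ, -1 ≤ x ∧ S = upperRam L x} = {S | ∃ i, i ≤ n ∧ S = H i} := by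
  rw [← hH.lowerRam_range h]
  ext S
  constructor
  · rintro ⟨x, hx, rfl⟩
    exact ⟨_, hH.herbrandInv_mem h hx, rfl⟩
  · rintro ⟨t, ht, rfl⟩
    refine ⟨herbrand L t, hH.neg_one_le_herbrand h ht, ?_⟩
    rw [upperRam, hH.herbrandInv_herbrand h ht]

end Herbrand

/-! ### The base of the tower and the size of `D_i` at `α`. -/

section BaseField

open WithZero

theorem totRam_bot {K : Type*} [Field K] [Valued K ℤᵐ⁰] {E : Type*} [Field E] [Algebra K E]
    (hsurj : Function.Surjective (Valued.v : Valuation K ℤᵐ⁰)) {w : Valuation E ℝᵐ⁰}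
    (hw : ∀ c : K, c ≠ 0 → w (algebraMap K E c) = exp ((log (Valued.v c) : ℤ) : ℝ)) :
    TotRam w (⊥ : IntermediateField K E) 1 := by
  refine ⟨one_pos, ?_, ?_, ?_, IntermediateField.finrank_bot⟩
  · intro x hx hx0
    obtain ⟨c, rfl⟩ := IntermediateField.mem_bot.1 hx
    refine ⟨log (Valued.v c), ?_⟩
    rw [hw c (by rintro rfl; simp at hx0), Nat.cast_one, div_one]
  · intro m
    obtain ⟨c, hc⟩ := hsurj (exp m)
    have hc0 : c ≠ 0 := by
      rintro rfl
      rw [map_zero] at hc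
      exact exp_ne_zero hc.symm
    refine ⟨algebraMap K E c, IntermediateField.mem_bot.2 ⟨c, rfl⟩, ?_⟩
    rw [hw c hc0, hc, log_exp, Nat.cast_one, div_one]
  · intro x hx _
    obtain ⟨c, rfl⟩ := IntermediateField.mem_bot.1 hx
    exact ⟨c, by simp⟩

/-- Coefficients from `𝔽_p` have valuation at most `1`, so only the degrees of the monomials count.
-/
theorem valuation_evalAt_le {p : ℕ} {K : Type*} [Field K] [CharP K p] {E : Type*} [Field E]
    [Algebra K E] [Fact p.Prime] (v : Valuation E ℝᵐ⁰) {α : ℕ → E}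
    {P : MvPolynomial ℕ (ZMod p)} {r : ℝ} (hr : 0 ≤ r) (h : ∀ j ∈ P.vars, v (α j) ≤ exp r) :
    v (evalAt K α P) ≤ exp (P.totalDegree * r) := by
  rw [evalAt, MvPolynomial.eval₂_eq]
  refine v.map_sum_le fun d hd => ?_
  rw [map_mul, map_prod]
  have h1 : v (((algebraMap K E).comp (ZMod.castHom (dvd_refl p) K)) (P.coeff d)) ≤ 1 := by
    rw [← ZMod.natCast_zmod_val (P.coeff d), map_natCast]
    exact valuation_natCast_le_one v _
  refine (mul_le_of_le_one_left' h1).trans ?_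
  have h2 : ∏ i ∈ d.support, v (α i ^ d i) ≤ ∏ i ∈ d.support, exp (d i * r) := by
    refine Finset.prod_le_prod' fun i hi => ?_
    rw [map_pow, ← exp_real_pow]
    exact pow_le_pow_left' (h i ((MvPolynomial.mem_vars_iff_mem_support i).2 ⟨d, hd, hi⟩)) _
  refine h2.trans ?_
  have h3 : ∏ i ∈ d.support, (exp (d i * r) : ℝᵐ⁰) = exp ((∑ i ∈ d.support, d i : ℕ) * r) := by
    push_cast
    rw [Finset.sum_mul]
    generalize d.support = s
    induction s using Finset.induction_on with
    | empty => simp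
    | insert a s ha ih => rw [Finset.prod_insert ha, Finset.sum_insert ha, ih, exp_add]
  rw [h3, exp_le_exp]
  gcongr
  exact MvPolynomial.le_totalDegree hd

end BaseField

end RamTower

end

/-! ### Assembly of the theorem. -/

theorem mainTheorem8 (p n : ℕ) [Fact p.Prime]
    {G : Type*} [Group G] (F : RamTower.PFilteredGroup p n G)
    (D : ℕ → MvPolynomial ℕ (ZMod p)) (hD : RamTower.IsGenericSystem F D)
    -- `K` is complete for a normalized discrete valuation, with perfect residue field
    {K : Type*} [Field K] [CharP K p] [Valued K ℤᵐ⁰] [CompleteSpace K]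
    (hsurj : Function.Surjective (Valued.v : Valuation K ℤᵐ⁰)) [PerfectField 𝓀[K]]
    {E : Type*} [Field E] [Algebra K E] [IsSepClosure K E]
    (u : ℕ → ℕ) (hu_pos : ∀ i, 1 ≤ i → i ≤ n → 0 < u i)
    (hu_lt : ∀ i, 1 ≤ i → i < n → u i < u (i + 1))
    (hu_p : ∀ i, 1 ≤ i → i ≤ n → ¬ p ∣ u i)
    -- `v_K(a_i) = -u_i`, in multiplicative notation
    (a : ℕ → K) (ha : ∀ i, 1 ≤ i → i ≤ n → Valued.v (a i) = WithZero.exp (u i : ℤ))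
    (α : ℕ → E)
    (hα : ∀ i, 1 ≤ i → i ≤ n →
      α i ^ p - α i = RamTower.evalAt K α (D i) + algebraMap K E (a i))
    (b : ℕ → ℤ) (hb_one : b 1 = u 1)
    (hb_succ : ∀ i, 1 ≤ i → i < n → b (i + 1) - b i = (p : ℤ) ^ i * ((u (i + 1) : ℤ) - u i))
    (hb : ∀ i, 1 ≤ i → i ≤ n → i ∉ F.splitSet →
      (p : ℤ) ^ (i - 2) * (D i).totalDegree * u (i - 1) < b i) :
    -- (a)
    (IsGalois K (RamTower.tower K α n) ∧
      ∃ μ : (RamTower.tower K α n ≃ₐ[K] RamTower.tower K α n) ≃* G,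
        ∀ i, i ≤ n → (RamTower.towerGal K α n i).map μ.toMonoidHom = F.sub i) ∧
    -- (b)
    (RamTower.upperBreaks (RamTower.tower K α n) = {x : ℝ | ∃ i, 1 ≤ i ∧ i ≤ n ∧ x = u i} ∧
      RamTower.lowerBreaks (RamTower.tower K α n) = {x : ℝ | ∃ i, 1 ≤ i ∧ i ≤ n ∧ x = b i} ∧
      ∀ i, 1 ≤ i → i ≤ n → RamTower.extVal K (α i) = ((-(u i : ℝ) / p : ℝ) : EReal)) ∧
    -- (c), for the lower and for the upper numbering
    ({H | ∃ t : ℝ, -1 ≤ t ∧ H = RamTower.lowerRam (RamTower.tower K α n) t} =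
        {H | ∃ i, i ≤ n ∧ H = (RamTower.towerGal K α n i :
          Set (RamTower.tower K α n ≃ₐ[K] RamTower.tower K α n))} ∧
      {H | ∃ x : ℝ, -1 ≤ x ∧ H = RamTower.upperRam (RamTower.tower K α n) x} =
        {H | ∃ i, i ≤ n ∧ H = (RamTower.towerGal K α n i :
          Set (RamTower.tower K α n ≃ₐ[K] RamTower.tower K α n))}) := by
  open RamTower WithZero in
  have hp : p.Prime := Fact.out
  have hp0 : (0 : ℝ) < p := by exact_mod_cast hp.pos
  have : IsGalois K E := IsSepClosure.isGalois
  have : CharP E p := charP_of_injective_algebraMap (algebraMap K E).injective p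
  have h : BreakData p n u b := ⟨hu_pos, hu_lt, hu_p, hb_one, hb_succ⟩
  obtain ⟨w, hw, hwK⟩ := exists_valuation (E := E) hsurj
  have hperf : ∀ c : K, w (algebraMap K E c) ≤ 1 →
      ∃ d : K, w (algebraMap K E (d ^ p - c)) < 1 := by
    intro c hc
    rw [valuation_algebraMap_le_one_iff hwK] at hc
    obtain ⟨d, hd⟩ := exists_pow_sub_valuation_lt_one p hc
    exact ⟨d, (valuation_algebraMap_lt_one_iff hwK _).2 hd⟩
  have hwa : ∀ i, 1 ≤ i → i ≤ n → w (algebraMap K E (a i)) = exp (u i : ℝ) := by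
    intro i h1 h2
    have h0 : a i ≠ 0 := by
      rw [← Valuation.ne_zero_iff (Valued.v : Valuation K ℤᵐ⁰), ha i h1 h2]
      exact exp_ne_zero
    rw [hwK _ h0, ha i h1 h2, log_exp, Int.cast_natCast]
  have hdmem : ∀ i < n, evalAt K α (D (i + 1)) ∈ tower K α i := fun i hi =>
    evalAt_mem_tower ⟨D (i + 1), hD.mem_genS hi⟩
  have hdv : ∀ i < n, (∀ j, 1 ≤ j → j ≤ i → w (α j) = exp ((u j : ℝ) / p)) →
      w (evalAt K α (D (i + 1))) < exp ((b (i + 1) : ℝ) / ((p ^ i : ℕ) : ℝ)) := by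
    intro i hi hval
    by_cases hS : i + 1 ∈ F.splitSet
    · rw [hD.eq_zero _ hS, evalAt, MvPolynomial.eval₂_zero, map_zero]
      exact exp_pos
    have hbi := hb (i + 1) (by omega) hi hS
    -- The index `1` always lies in `Σ_G`, as `G / G_(0)` is trivial.
    rcases Nat.eq_zero_or_pos i with rfl | hi0
    · exfalso
      refine hS ⟨le_rfl, hi, 1, fun x => ?_⟩
      obtain ⟨g, rfl⟩ := QuotientGroup.mk_surjective x
      have hg : g ∈ F.sub 0 := by rw [F.sub_zero]; trivial
      exact ((QuotientGroup.eq_one_iff g).2 hg).symm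
    obtain ⟨k, rfl⟩ : ∃ k, i = k + 1 := ⟨i - 1, by omega⟩
    -- The variables of `D (i + 1)` are among `Y_1, …, Y_i`, whose values have pole order at most `u
    -- i / p`. The resulting bound `l_{i+1} u_i / p`, multiplied by `p ^ i`, is the left side of the
    -- hypothesis on `b (i + 1)`.
    have hle := valuation_evalAt_le (K := K) w (α := α) (P := D (k + 1 + 1))
      (r := (u (k + 1) : ℝ) / p) (by positivity) fun j hj => by
        have hj' := MvPolynomial.mem_supported.1 (hD.mem_genS hi) hj
        rw [hval j hj'.1 hj'.2, exp_le_exp]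
        gcongr
        exact_mod_cast h.u_le_of_le hj'.1 hj'.2 hi.le
    refine hle.trans_lt ?_
    rw [exp_lt_exp]
    have h3 : (p : ℝ) ^ k * (D (k + 1 + 1)).totalDegree * u (k + 1) < b (k + 1 + 1) := by
      exact_mod_cast hbi
    push_cast
    rw [lt_div_iff₀ (by positivity), pow_succ]
    calc _ = (p : ℝ) ^ k * (D (k + 1 + 1)).totalDegree * u (k + 1) := by field_simp
      _ < _ := h3
  obtain ⟨hram, hgen, hval⟩ := totRam_tower h hperf (totRam_bot hsurj hwK) hwa hα hdmem hdv le_rfl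
  have hrank : ∀ i ≤ n, Module.finrank K (tower K α i) = p ^ i := fun i hi => (hram i hi).finrank
  obtain ⟨μ, hμ⟩ := exists_mulEquiv_gal hD hα hrank
  have hfin : FiniteDimensional K (tower K α n) := by
    apply FiniteDimensional.of_finrank_pos
    rw [hrank n le_rfl]
    exact pow_pos hp.pos n
  have hH : IsLowerFiltration p n b (tower K α n)
      (fun i => (towerGal K α n i : Set (tower K α n ≃ₐ[K] tower K α n))) := by
    refine ⟨inferInstance, fun i hi t ht => lowerRam_tower h hw hram hgen hi ht.1 ht.2,
      fun i hi => ?_⟩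
    rw [← Nat.card_coe_set_eq, ← F.card_sub i, ← hμ i hi]
    exact (Subgroup.card_map_of_injective μ.injective).symm
  refine ⟨⟨isGalois_tower hD hα, μ, hμ⟩, ⟨hH.upperBreaks_eq h, hH.lowerBreaks_eq h, ?_⟩,
    hH.lowerRam_range h, hH.upperRam_range h⟩
  intro i h1 h2
  have h3 := hval i h1 h2
  have h0 : α i ≠ 0 := by
    intro h0
    rw [h0, map_zero] at h3
    exact exp_ne_zero h3.symm
  rw [hw _ h0, h3, log_exp, neg_div]
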